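/- Let $\tau>0$, $d,m\in\mathbb N$, and let $W$ be an $m$-dimensional Brownian motion on a probability space $(\Omega,\mathcal F,\mathbb P)$. Let $|\cdot|$ denote the Euclidean norm on $\mathbb R^d$ and the norm $|A|=\sqrt{\operatorname{trace}(A^{T}A)}$ on $\mathbb R^{d\times m}$; let $C=C([-\tau,0];\mathbb R^d)$ carry the norm $\|X\|=\sup_{-\tau\le\theta\le0}|X(\theta)|$, and let $B(M)=\{X\in C:\|X\|\le M\}$. Let $f:\mathbb R^d\times\mathbb R^d\to\mathbb R^d$ and $g:\mathbb R^d\times\mathbb R^d\to\mathbb R^{d\times m}$ satisfy: (H1) for every $R>0$ there is $\ell_R>0$ with $|f(x,y)-f(\bar x,\bar y)|\vee|g(x,y)-g(\bar x,\bar y)|\le\ell_R(|x-\bar x|+|y-\bar y|)$ whenever $|x|\vee|\bar x|\vee|y|\vee|\bar y|\le R$; (H2) there are constants $\alpha\ge2$ and $a_1,a_2,a_3\ge0$ with $a_2>a_3$ and $\langle 2x,f(x,y)\rangle+|g(x,y)|^2\le a_1-a_2|x|^\alpha+a_3|y|^\alpha$ for all $x,y\in\mathbb R^d$. Let $\Phi:[1,\infty)\to[0,\infty)$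 be a strictly increasing continuous function with $\Phi(R)\to\infty$ as $R\to\infty$ and, for every $R\ge1$, $$\sup_{|x|\vee|\bar x|\vee|y|\vee|\bar y|\le R}\left(\frac{|f(x,y)-f(\bar x,\bar y)|}{|x-\bar x|+1\wedge|y-\bar y|}+\frac{|g(x,y)-g(\bar x,\bar y)|^2}{(|x-\bar x|+1\wedge|y-\bar y|)^2}\right)\le\Phi(R)$$ (with $0/0=0$). Put $K=1\vee\Phi(1)\vee|f(0,0)|\vee|g(0,0)|^2$, let $\nu\in(0,1/3]$, and for $\triangle\in(0,1)$ let $\Gamma^{\triangle}(x)=\big(|x|\wedge\Phi^{-1}(K\triangle^{-\nu})\big)\frac{x}{|x|}$, $\Gamma^\triangle(0)=0$. For a step size $\triangle\in(0,1)$ of the form $\triangle=\tau/N$ with $N$ a positive integer, put $t_k=k\triangle$ for $k\ge-N$. For $\xi\in C$ define the truncated Euler-Maruyama scheme by $\breve u(t_k)=\xi(t_k)$ for $-N\le k\le0$, $u(t_k)=\Gamma^\triangle(\breve u(t_k))$ for $k\ge-N$, and $$\breve u(t_{k+1})=u(t_k)+f(u(t_k),u(t_{k-N}))\triangle+g(u(t_k),u(t_{k-N}))\big(W(t_{k+1})-W(t_k)\big),\qquad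 k\ge0.$$ Let $y(t)=\Gamma^\triangle(\xi(t))$ for $t\in[-\tau,0]$ and $y(t)=\frac{t_{k+1}-t}{\triangle}u(t_k)+\frac{t-t_k}{\triangle}u(t_{k+1})$ for $t\in[t_k,t_{k+1}]$, $k\ge0$. The truncated EM segment process (TEMSP) is the $C$-valued process $Y^{\xi,\triangle}_{t_k}(\theta)=y(t_k+\theta)$, $\theta\in[-\tau,0]$, $k\ge0$. Let $\hat\triangle_1\in(0,1)$ satisfy $a_2-6K^2\hat\triangle_1^{1-2\nu}>a_3$. Then for all $M>0$ and $\varepsilon>0$ there is a $\Lambda^*>M$ such that $$\sup_{\triangle\in(0,\hat\triangle_1]}\ \sup_{k\ge0}\ \sup_{\xi\in B(M)}\mathbb P\big\{\|Y^{\xi,\triangle}_{t_k}\|>\Lambda^*\big\}<\varepsilon,$$ where the supremum over $\triangle$ runs over the step sizes $\triangle=\tau/N$, $N\in\{1,2,\dots\}$, in $(0,\hat\triangle_1]$. -/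

import Mathlib

open MeasureTheory ProbabilityTheory Filter
open scoped NNReal ENNReal Matrix.Norms.Frobenius

noncomputable section

/-- An `m`-dimensional standard Brownian motion on the probability space `(Ω, P)`. -/
structure IsBrownianMotion {m : ℕ} {Ω : Type*} [MeasurableSpace Ω]
    (W : ℝ≥0 → Ω → EuclideanSpace ℝ (Fin m)) (P : Measure Ω) : Prop where
  measurable : ∀ t, Measurable (W t)
  zero : ∀ᵐ ω ∂P, W 0 ω = 0
  indep_increments : HasIndepIncrements W P
  law_increments : ∀ s t : ℝ≥0, s ≤ t →
    HasLaw (fun ω => W t ω - W s ω)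
      (multivariateGaussian 0 (((t : ℝ) - (s : ℝ)) • (1 : Matrix (Fin m) (Fin m) ℝ))) P
  continuous_paths : ∀ᵐ ω ∂P, Continuous fun t => W t ω

section Coefficients

variable {d m : ℕ}
  (f : EuclideanSpace ℝ (Fin d) → EuclideanSpace ℝ (Fin d) → EuclideanSpace ℝ (Fin d))
  (g : EuclideanSpace ℝ (Fin d) → EuclideanSpace ℝ (Fin d) → Matrix (Fin d) (Fin m) ℝ)

/-- The local Lipschitz condition on the coefficients. Matrices carry the Frobenius norm
`|A| = √(trace (Aᵀ A))`. -/
def LocallyLipschitzCoeff : Prop :=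
  ∀ R : ℝ, 0 < R → ∃ l : ℝ, 0 < l ∧
    ∀ x x' y y' : EuclideanSpace ℝ (Fin d), ‖x‖ ≤ R → ‖x'‖ ≤ R → ‖y‖ ≤ R → ‖y'‖ ≤ R →
      max ‖f x y - f x' y'‖ ‖g x y - g x' y'‖ ≤ l * (‖x - x'‖ + ‖y - y'‖)

/-- The dissipativity (Khasminskii-type) condition with constants `α, a₁, a₂, a₃`. -/
structure Dissipative (α a₁ a₂ a₃ : ℝ) : Prop where
  two_le : 2 ≤ α
  nonneg₁ : 0 ≤ a₁
  nonneg₂ : 0 ≤ a₂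
  nonneg₃ : 0 ≤ a₃
  lt : a₃ < a₂
  bound : ∀ x y : EuclideanSpace ℝ (Fin d),
    inner ℝ ((2 : ℝ) • x) (f x y) + ‖g x y‖ ^ 2 ≤ a₁ - a₂ * ‖x‖ ^ α + a₃ * ‖y‖ ^ α

/-- `Φ : [1, ∞) → [0, ∞)` is strictly increasing, continuous, tends to `∞` and dominates the
difference quotients of `f` and the squared difference quotients of `g` on balls of radius `R`
(at `x = x'`, `y = y'` the quotients read `0`). -/
structure IsGrowthControl (Φ : Set.Ici (1 : ℝ) → ℝ≥0) : Prop where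
  strictMono : StrictMono Φ
  continuous : Continuous Φ
  tendsto : Tendsto Φ atTop atTop
  bound : ∀ (R : Set.Ici (1 : ℝ)) (x x' y y' : EuclideanSpace ℝ (Fin d)),
    ‖x‖ ≤ R → ‖x'‖ ≤ R → ‖y‖ ≤ R → ‖y'‖ ≤ R →
      ‖f x y - f x' y'‖ / (‖x - x'‖ + min 1 ‖y - y'‖)
        + ‖g x y - g x' y'‖ ^ 2 / (‖x - x'‖ + min 1 ‖y - y'‖) ^ 2 ≤ Φ R

variable (Φ : Set.Ici (1 : ℝ) → ℝ≥0)

/-- The constant `K = 1 ∨ Φ(1) ∨ |f(0,0)| ∨ |g(0,0)|²`. -/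
def truncConst : ℝ :=
  max (max (max 1 (Φ ⟨1, Set.self_mem_Ici⟩ : ℝ)) ‖f 0 0‖) (‖g 0 0‖ ^ 2)

/-- The truncation radius `Φ⁻¹(K Δ^{-ν})`. Under `IsGrowthControl`, for `Δ ∈ (0,1)` and `ν > 0`,
the argument lies in the range `[Φ(1), ∞)` of `Φ`. -/
def truncRadius (ν Δ : ℝ) : Set.Ici (1 : ℝ) :=
  Function.invFun Φ (Real.toNNReal (truncConst f g Φ * Δ ^ (-ν)))

/-- The truncation mapping `x ↦ (|x| ∧ Φ⁻¹(K Δ^{-ν})) x / |x|`, equal to `0` at `x = 0`. -/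
def truncMap (ν Δ : ℝ) (x : EuclideanSpace ℝ (Fin d)) : EuclideanSpace ℝ (Fin d) :=
  min ‖x‖ (truncRadius f g Φ ν Δ : ℝ) • (‖x‖⁻¹ • x)

theorem continuous_truncMap (ν Δ : ℝ) : Continuous (truncMap f g Φ ν Δ) := by
  have hr : (0 : ℝ) ≤ (truncRadius f g Φ ν Δ : ℝ) :=
    zero_le_one.trans (truncRadius f g Φ ν Δ).2
  rw [continuous_iff_continuousAt]
  intro x
  by_cases hx : x = 0
  · subst hx
    have h0 : truncMap f g Φ ν Δ 0 = 0 := by simp [truncMap]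
    rw [ContinuousAt, h0]
    refine squeeze_zero_norm (a := fun y => ‖y‖) (fun y => ?_) ?_
    · by_cases hy : y = 0
      · simp [hy, h0]
      · have : ‖y‖ ≠ 0 := norm_ne_zero_iff.2 hy
        rw [truncMap, norm_smul, norm_smul, norm_inv, norm_norm, inv_mul_cancel₀ this, mul_one,
          Real.norm_of_nonneg (le_min (norm_nonneg _) hr)]
        exact min_le_left _ _
    · simpa using (continuous_norm (E := EuclideanSpace ℝ (Fin d))).tendsto 0
  · have : ‖x‖ ≠ 0 := norm_ne_zero_iff.2 hx
    unfold truncMap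
    exact (continuousAt_id.norm.min continuousAt_const).smul
      ((continuousAt_id.norm.inv₀ this).smul continuousAt_id)

variable (ν : ℝ) {τ : ℝ} (hτ : 0 < τ) (N : ℕ+)

/-- The step size `Δ = τ / N`. -/
def stepSize (τ : ℝ) (N : ℕ+) : ℝ := τ / (N : ℕ)

theorem stepSize_pos {τ : ℝ} (hτ : 0 < τ) (N : ℕ+) : 0 < stepSize τ N :=
  div_pos hτ (Nat.cast_pos.2 N.pos)

/-- The continuous initial path `ξ` as a function of real time; it is only evaluated on
`[-τ, 0]` below. -/
def initPath (ξ : C(Set.Icc (-τ) 0, EuclideanSpace ℝ (Fin d))) : ℝ → EuclideanSpace ℝ (Fin d) :=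
  Set.IccExtend (neg_nonpos.2 hτ.le) ξ

/-- The increment `W(t_{k+1}) - W(t_k)` of the path `w` over the `k`-th step, `k ≥ 0`. -/
def pathIncrement (τ : ℝ) (N : ℕ+) (w : ℝ≥0 → EuclideanSpace ℝ (Fin m)) (k : ℤ) :
    EuclideanSpace ℝ (Fin m) :=
  w (Real.toNNReal (((k : ℝ) + 1) * stepSize τ N)) - w (Real.toNNReal ((k : ℝ) * stepSize τ N))

variable (ξ : C(Set.Icc (-τ) 0, EuclideanSpace ℝ (Fin d)))
  (w : ℝ≥0 → EuclideanSpace ℝ (Fin m))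

/-- The untruncated iterates `ŭ(t_k)`, `k ≥ -N`, of the truncated Euler-Maruyama scheme along the
driving path `w`: `ŭ(t_k) = ξ(t_k)` for `-N ≤ k ≤ 0`, and
`ŭ(t_{k+1}) = u(t_k) + f(u(t_k), u(t_{k-N})) Δ + g(u(t_k), u(t_{k-N})) (w(t_{k+1}) - w(t_k))`
for `k ≥ 0`, where `u = Γ ∘ ŭ`. Values at `k < -N` are never used. -/
def preEM (k : ℤ) : EuclideanSpace ℝ (Fin d) :=
  if _h : k ≤ 0 then initPath hτ ξ ((k : ℝ) * stepSize τ N)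
  else
    let u₀ := truncMap f g Φ ν (stepSize τ N) (preEM (k - 1))
    let u₁ := truncMap f g Φ ν (stepSize τ N) (preEM (k - 1 - (N : ℕ)))
    u₀ + stepSize τ N • f u₀ u₁ + Matrix.toEuclideanLin (g u₀ u₁) (pathIncrement τ N w (k - 1))
termination_by k.toNat
decreasing_by all_goals omega

/-- The truncated iterates `u(t_k) = Γ(ŭ(t_k))`. -/
def truncEM (k : ℤ) : EuclideanSpace ℝ (Fin d) :=
  truncMap f g Φ ν (stepSize τ N) (preEM f g Φ ν hτ N ξ w k)

theorem truncEM_of_nonpos {k : ℤ} (hk : k ≤ 0) :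
    truncEM f g Φ ν hτ N ξ w k
      = truncMap f g Φ ν (stepSize τ N) (initPath hτ ξ ((k : ℝ) * stepSize τ N)) := by
  rw [truncEM, preEM, dif_pos hk]

theorem truncEM_succ {k : ℤ} (hk : 0 ≤ k) :
    truncEM f g Φ ν hτ N ξ w (k + 1)
      = truncMap f g Φ ν (stepSize τ N)
        (truncEM f g Φ ν hτ N ξ w k
          + stepSize τ N • f (truncEM f g Φ ν hτ N ξ w k) (truncEM f g Φ ν hτ N ξ w (k - (N : ℕ)))
          + Matrix.toEuclideanLin
              (g (truncEM f g Φ ν hτ N ξ w k) (truncEM f g Φ ν hτ N ξ w (k - (N : ℕ))))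
              (pathIncrement τ N w k)) := by
  rw [truncEM, preEM, dif_neg (by omega)]
  simp only [add_sub_cancel_right]
  rfl

/-- The continuous process `y`: `y(t) = Γ(ξ(t))` on `[-τ, 0]`, and the piecewise linear
interpolation of the `u(t_k)` on `[0, ∞)`. -/
def interpEM (t : ℝ) : EuclideanSpace ℝ (Fin d) :=
  if t ≤ 0 then truncMap f g Φ ν (stepSize τ N) (initPath hτ ξ t)
  else
    let k : ℤ := ⌊t / stepSize τ N⌋
    ((((k : ℝ) + 1) * stepSize τ N - t) / stepSize τ N) • truncEM f g Φ ν hτ N ξ w k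
      + ((t - (k : ℝ) * stepSize τ N) / stepSize τ N) • truncEM f g Φ ν hτ N ξ w (k + 1)

theorem interpEM_of_mem_Icc {k : ℕ} {t : ℝ}
    (ht : t ∈ Set.Icc ((k : ℝ) * stepSize τ N) (((k : ℝ) + 1) * stepSize τ N)) :
    interpEM f g Φ ν hτ N ξ w t
      = ((((k : ℝ) + 1) * stepSize τ N - t) / stepSize τ N) • truncEM f g Φ ν hτ N ξ w k
        + ((t - (k : ℝ) * stepSize τ N) / stepSize τ N) • truncEM f g Φ ν hτ N ξ w (k + 1) := by
  have hΔ := stepSize_pos hτ N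
  rcases ht with ⟨h1, h2⟩
  by_cases h0 : t ≤ 0
  · have hk : (k : ℝ) = 0 := by
      by_contra hk
      have : 0 < (k : ℝ) := lt_of_le_of_ne (Nat.cast_nonneg k) (Ne.symm hk)
      have := mul_pos this hΔ
      linarith
    have hk' : k = 0 := by exact_mod_cast hk
    subst hk'
    have ht : t = 0 := le_antisymm h0 (by simpa using h1)
    subst ht
    have : truncEM f g Φ ν hτ N ξ w ((0 : ℕ) : ℤ)
        = truncMap f g Φ ν (stepSize τ N) (initPath hτ ξ 0) := by
      rw [truncEM_of_nonpos f g Φ ν hτ N ξ w (by simp)]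
      simp
    rw [this, interpEM, if_pos le_rfl]
    simp [hΔ.ne']
  · rw [interpEM, if_neg h0]
    rcases h2.lt_or_eq with h2 | h2
    · have : ⌊t / stepSize τ N⌋ = (k : ℤ) := by
        rw [Int.floor_eq_iff]
        constructor
        · rw [le_div_iff₀ hΔ]
          exact_mod_cast h1
        · rw [div_lt_iff₀ hΔ]
          exact_mod_cast h2
      rw [this]
      simp
    · have : ⌊t / stepSize τ N⌋ = (k : ℤ) + 1 := by
        rw [h2, mul_div_cancel_right₀ _ hΔ.ne']
        exact_mod_cast Int.floor_natCast (R := ℝ) (k + 1)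
      rw [this, h2]
      have e1 : ((k : ℝ) + 1 + 1) * stepSize τ N - ((k : ℝ) + 1) * stepSize τ N
          = stepSize τ N := by ring
      have e2 : ((k : ℝ) + 1) * stepSize τ N - (k : ℝ) * stepSize τ N = stepSize τ N := by ring
      simp [e1, e2, hΔ.ne']

theorem continuous_interpEM : Continuous (interpEM f g Φ ν hτ N ξ w) := by
  have hΔ := stepSize_pos hτ N
  have key : ∀ k : ℕ, ContinuousOn (interpEM f g Φ ν hτ N ξ w)
      (Set.Iic ((k : ℝ) * stepSize τ N)) := by
    intro k
    induction k with
    | zero =>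
      have : ContinuousOn (fun t => truncMap f g Φ ν (stepSize τ N) (initPath hτ ξ t))
          (Set.Iic (((0 : ℕ) : ℝ) * stepSize τ N)) :=
        ((continuous_truncMap f g Φ ν _).comp ξ.continuous.Icc_extend').continuousOn
      refine this.congr fun t ht => ?_
      have ht : t ≤ 0 := by simpa using ht
      rw [interpEM, if_pos ht]
    | succ k ih =>
      have h : Set.Iic (((k + 1 : ℕ) : ℝ) * stepSize τ N)
          = Set.Iic ((k : ℝ) * stepSize τ N)
            ∪ Set.Icc ((k : ℝ) * stepSize τ N) (((k : ℝ) + 1) * stepSize τ N) := by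
        rw [Set.Iic_union_Icc_eq_Iic (by nlinarith)]
        push_cast
        rfl
      rw [h]
      refine ih.union_of_isClosed ?_ isClosed_Iic isClosed_Icc
      refine ContinuousOn.congr ?_ fun t ht => interpEM_of_mem_Icc f g Φ ν hτ N ξ w ht
      fun_prop
  rw [continuous_iff_continuousAt]
  intro t
  obtain ⟨k, hk⟩ := exists_nat_gt (t / stepSize τ N)
  exact (key k).continuousAt (Iic_mem_nhds ((div_lt_iff₀ hΔ).1 hk))

/-- The truncated Euler-Maruyama segment process `Y_{t_k}(θ) = y(t_k + θ)`, `θ ∈ [-τ, 0]`, as an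
element of `C([-τ, 0]; ℝ^d)` with the supremum norm. -/
def temsp (k : ℕ) : C(Set.Icc (-τ) 0, EuclideanSpace ℝ (Fin d)) where
  toFun θ := interpEM f g Φ ν hτ N ξ w ((k : ℝ) * stepSize τ N + θ)
  continuous_toFun := (continuous_interpEM f g Φ ν hτ N ξ w).comp (by fun_prop)

end Coefficients

end

/-! After one step of size `Δ` the noise contributes exactly `Δ |g|²` to the conditional second
moment, and truncation only decreases norms. Since `|f|² ≤ 6 K² Δ^{-2ν} (1 + |x|²)` on the
truncation ball, the term `Δ² |f|²` is absorbed by the dissipativity of the coefficients at the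
price of lowering `a₂` to `b = a₂ - 6 K² Δ₁^{1 - 2ν} > a₃`. The delay is absorbed by adding to
`|u(t_k)|²` the sum of the last `N` terms `Δ |u(t_{k-1-i})|^α`, weighted linearly from a level
`c ∈ (a₃, b)` down to `a₃`: the resulting functional `V_k` satisfies
`E[V_{k+1} | 𝓕_k] ≤ (1 - κ Δ) V_k + Δ (C + κ)` with `κ > 0` independent of `Δ`, `k` and `ξ`.
Hence `E V_k` is bounded uniformly. The segment at `t_k` sees only the last `N + 1` iterates, over
which the drift accumulates to at most `N Δ (C + κ) = τ (C + κ)`, so a maximal inequality over this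
window bounds the tail of its norm. -/

section GeometricDrift

variable {Ω : Type*} {mΩ : MeasurableSpace Ω} {P : Measure Ω} {𝓕 : Filtration ℕ mΩ}
  {H : ℕ → Ω → ℝ≥0∞} {q c : ℝ≥0∞}

/-- The Foster-Lyapunov drift condition `E[H_{n+1} | 𝓕_n] ≤ q H_n + c`, tested on the events of
`𝓕_n` so that no integrability of `H` is presupposed. -/
def HasGeometricDrift (H : ℕ → Ω → ℝ≥0∞) (𝓕 : Filtration ℕ mΩ) (P : Measure Ω) (q c : ℝ≥0∞) :
    Prop :=
  ∀ n A, MeasurableSet[𝓕 n] A →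
    ∫⁻ ω in A, H (n + 1) ω ∂P ≤ q * ∫⁻ ω in A, H n ω ∂P + c * P A

theorem HasGeometricDrift.lintegral_le [IsProbabilityMeasure P] (h : HasGeometricDrift H 𝓕 P q c)
    {B : ℝ≥0∞} (h0 : ∫⁻ ω, H 0 ω ∂P ≤ B) (hB : q * B + c ≤ B) (n : ℕ) :
    ∫⁻ ω, H n ω ∂P ≤ B := by
  induction n with
  | zero => exact h0
  | succ n ih =>
    calc ∫⁻ ω, H (n + 1) ω ∂P ≤ q * ∫⁻ ω, H n ω ∂P + c := by
          simpa using h n Set.univ MeasurableSet.univ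
      _ ≤ q * B + c := by gcongr
      _ ≤ B := hB

theorem mul_measure_union_add_setLIntegral_compl_le {A : Set Ω} (hA : MeasurableSet A)
    {h : Ω → ℝ≥0∞} (hh : Measurable h) (r : ℝ≥0∞) :
    r * P (A ∪ {ω | r < h ω}) + ∫⁻ ω in (A ∪ {ω | r < h ω})ᶜ, h ω ∂P
      ≤ r * P A + ∫⁻ ω in Aᶜ, h ω ∂P := by
  set S := {ω | r < h ω}
  have hS : MeasurableSet S := hh measurableSet_Ioi
  have hunion : P (A ∪ S) ≤ P A + P (Aᶜ ∩ S) := by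
    rw [← Set.union_sdiff_self, Set.inter_comm, ← Set.sdiff_eq]
    exact measure_union_le _ _
  have hmarkov : r * P (Aᶜ ∩ S) ≤ ∫⁻ ω in Aᶜ ∩ S, h ω ∂P := by
    rw [← setLIntegral_const]
    exact setLIntegral_mono' (hA.compl.inter hS) fun ω hω => hω.2.le
  calc r * P (A ∪ S) + ∫⁻ ω in (A ∪ S)ᶜ, h ω ∂P
      ≤ r * (P A + P (Aᶜ ∩ S)) + ∫⁻ ω in Aᶜ \ S, h ω ∂P := by
        rw [Set.compl_union, ← Set.sdiff_eq]
        gcongr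
    _ ≤ r * P A + (∫⁻ ω in Aᶜ ∩ S, h ω ∂P + ∫⁻ ω in Aᶜ \ S, h ω ∂P) := by
        rw [mul_add, add_assoc]
        gcongr
    _ = r * P A + ∫⁻ ω in Aᶜ, h ω ∂P := by rw [lintegral_inter_add_sdiff _ _ hS]

theorem setOf_exists_lt_succ (H : ℕ → Ω → ℝ≥0∞) (r : ℝ≥0∞) (s n : ℕ) :
    {ω | ∃ j < n + 1, r < H (s + j) ω}
      = {ω | ∃ j < n, r < H (s + j) ω} ∪ {ω | r < H (s + n) ω} := by
  ext ω
  exact Nat.exists_lt_succ_right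

theorem measurableSet_exists_lt (hH : ∀ n, Measurable[𝓕 n] (H n)) (r : ℝ≥0∞) (s n : ℕ) :
    MeasurableSet[𝓕 (s + n)] {ω | ∃ j < n, r < H (s + j) ω} := by
  induction n with
  | zero => simp
  | succ n ih =>
    rw [setOf_exists_lt_succ]
    exact 𝓕.mono (s + n).le_succ _ (ih.union (hH (s + n) measurableSet_Ioi))

theorem HasGeometricDrift.mul_measure_exists_lt_add_setLIntegral_le [IsProbabilityMeasure P]
    (h : HasGeometricDrift H 𝓕 P q c) (hH : ∀ n, Measurable[𝓕 n] (H n)) (hq : q ≤ 1) (r : ℝ≥0∞)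
    (s n : ℕ) :
    r * P {ω | ∃ j < n, r < H (s + j) ω}
      + ∫⁻ ω in {ω | ∃ j < n, r < H (s + j) ω}ᶜ, H (s + n) ω ∂P
      ≤ ∫⁻ ω, H s ω ∂P + n * c := by
  induction n with
  | zero => simp
  | succ n ih =>
    set A := fun n => {ω | ∃ j < n, r < H (s + j) ω}
    have hA : MeasurableSet (A n) := 𝓕.le _ _ (measurableSet_exists_lt hH r s n)
    have hAsucc : A (n + 1) = A n ∪ {ω | r < H (s + n) ω} := setOf_exists_lt_succ H r s n
    have hAm : MeasurableSet[𝓕 (s + n)] (A (n + 1))ᶜ := by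
      rw [hAsucc]
      exact ((measurableSet_exists_lt hH r s n).union (hH (s + n) measurableSet_Ioi)).compl
    calc r * P (A (n + 1)) + ∫⁻ ω in (A (n + 1))ᶜ, H (s + n + 1) ω ∂P
        ≤ r * P (A (n + 1)) + (q * ∫⁻ ω in (A (n + 1))ᶜ, H (s + n) ω ∂P + c * P (A (n + 1))ᶜ) := by
          gcongr
          exact h _ _ hAm
      _ ≤ r * P (A (n + 1)) + (1 * ∫⁻ ω in (A (n + 1))ᶜ, H (s + n) ω ∂P + c * 1) := by
          gcongr
          exact prob_le_one
      _ ≤ (r * P (A n) + ∫⁻ ω in (A n)ᶜ, H (s + n) ω ∂P) + c := by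
          rw [one_mul, mul_one, ← add_assoc, hAsucc]
          exact add_le_add_left (mul_measure_union_add_setLIntegral_compl_le hA
            ((hH _).mono (𝓕.le _) le_rfl) r) c
      _ ≤ (∫⁻ ω, H s ω ∂P + n * c) + c := by gcongr
      _ = ∫⁻ ω, H s ω ∂P + (n + 1 : ℕ) * c := by push_cast; ring

theorem HasGeometricDrift.mul_measure_exists_le_lt_le [IsProbabilityMeasure P]
    (h : HasGeometricDrift H 𝓕 P q c) (hH : ∀ n, Measurable[𝓕 n] (H n)) (hq : q ≤ 1) (r : ℝ≥0∞)
    (s n : ℕ) :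
    r * P {ω | ∃ j ≤ n, r < H (s + j) ω} ≤ ∫⁻ ω, H s ω ∂P + n * c := by
  simp_rw [← Nat.lt_succ_iff, setOf_exists_lt_succ]
  exact le_self_add.trans <| (mul_measure_union_add_setLIntegral_compl_le
    (𝓕.le _ _ (measurableSet_exists_lt hH r s n)) ((hH _).mono (𝓕.le _) le_rfl) r).trans
    (h.mul_measure_exists_lt_add_setLIntegral_le hH hq r s n)

end GeometricDrift

section Independence

variable {Ω E S : Type*} {mΩ : MeasurableSpace Ω} {P : Measure Ω} [MeasurableSpace E]

theorem lintegral_comp_of_indepFun [IsProbabilityMeasure P] [MeasurableSpace S] {X : Ω → S}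
    {Z : Ω → E} (hX : Measurable X) (hZ : Measurable Z) (hind : IndepFun X Z P) {F : S × E → ℝ≥0∞}
    (hF : Measurable F) :
    ∫⁻ ω, F (X ω, Z ω) ∂P = ∫⁻ ω, ∫⁻ z, F (X ω, z) ∂(P.map Z) ∂P := by
  have hlaw := (indepFun_iff_map_prod_eq_prod_map_map hX.aemeasurable hZ.aemeasurable).1 hind
  have : IsProbabilityMeasure (P.map Z) := Measure.isProbabilityMeasure_map hZ.aemeasurable
  have : IsProbabilityMeasure (P.map X) := Measure.isProbabilityMeasure_map hX.aemeasurable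
  rw [← lintegral_map hF (hX.prodMk hZ), hlaw, lintegral_prod _ hF.aemeasurable,
    lintegral_map hF.lintegral_prod_right' hX]

theorem setLIntegral_comp_of_indep [IsProbabilityMeasure P] {𝓖 : MeasurableSpace Ω}
    (h𝓖 : 𝓖 ≤ mΩ) {Z : Ω → E} (hZ : Measurable[mΩ] Z)
    (hind : Indep 𝓖 (MeasurableSpace.comap Z inferInstance) P)
    {F : Ω × E → ℝ≥0∞} (hF : Measurable[𝓖.prod inferInstance] F) {A : Set Ω}
    (hA : MeasurableSet[𝓖] A) :
    ∫⁻ ω in A, F (ω, Z ω) ∂P = ∫⁻ ω in A, ∫⁻ z, F (ω, z) ∂(@Measure.map _ _ mΩ _ Z P) ∂P := by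
  have hindFun : @IndepFun Ω Ω E mΩ 𝓖 _ id Z P := by
    rwa [IndepFun_iff_Indep, MeasurableSpace.comap_id]
  have hFA : Measurable[𝓖.prod inferInstance] (Set.indicator (Prod.fst ⁻¹' A) F) :=
    hF.indicator (measurable_fst hA)
  have key := @lintegral_comp_of_indepFun Ω E Ω mΩ P _ _ 𝓖 id Z (measurable_id'' h𝓖) hZ hindFun
    _ hFA
  rw [← lintegral_indicator (h𝓖 _ hA), ← lintegral_indicator (h𝓖 _ hA)]
  refine Eq.trans ?_ (key.trans ?_) <;> refine lintegral_congr fun ω => ?_ <;>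
    by_cases hω : ω ∈ A <;> simp [Set.indicator, hω]

/-- The filtration of strict pasts of a sequence: the events at time `k` are those determined by
`Z 0, …, Z (k - 1)`, so that `Z k` is not included. -/
def pastFiltration (Z : ℕ → Ω → E) (hZ : ∀ k, Measurable (Z k)) : Filtration ℕ mΩ where
  seq k := ⨆ i ∈ Set.Iio k, MeasurableSpace.comap (Z i) inferInstance
  mono' _ _ hkl := biSup_mono fun _ hi => lt_of_lt_of_le hi hkl
  le' _ := iSup₂_le fun i _ => (hZ i).comap_le

theorem measurable_pastFiltration_succ {Z : ℕ → Ω → E} (hZ : ∀ k, Measurable (Z k)) (k : ℕ) :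
    Measurable[pastFiltration Z hZ (k + 1)] (Z k) :=
  (comap_measurable (Z k)).mono
    (le_biSup (fun i => MeasurableSpace.comap (Z i) inferInstance) (Set.mem_Iio.2 k.lt_succ_self))
    le_rfl

theorem indep_pastFiltration {Z : ℕ → Ω → E} (hZ : ∀ k, Measurable (Z k)) (hind : iIndepFun Z P)
    (k : ℕ) : Indep (pastFiltration Z hZ k) (MeasurableSpace.comap (Z k) inferInstance) P := by
  have h := indep_iSup_of_disjoint (fun i => (hZ i).comap_le) hind.iIndep
    (S := Set.Iio k) (T := {k}) (by simp)
  simpa [pastFiltration] using h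

end Independence

section IsotropicNoise

/-- The measure has a finite second moment and, tested against linear functionals, mean `0` and
covariance `r` times the identity. -/
structure IsCentredIsotropic {E : Type*} [NormedAddCommGroup E] [InnerProductSpace ℝ E]
    [MeasurableSpace E] (μ : Measure E) (r : ℝ) : Prop where
  memLp_two : MemLp id 2 μ
  integral_inner : ∀ x, ∫ z, inner ℝ x z ∂μ = 0
  integral_inner_sq : ∀ x, ∫ z, inner ℝ x z ^ 2 ∂μ = r * ‖x‖ ^ 2

theorem integral_inner_multivariateGaussian_zero {ι : Type*} [Fintype ι] [DecidableEq ι]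
    (S : Matrix ι ι ℝ) (x : EuclideanSpace ℝ ι) :
    ∫ z, inner ℝ x z ∂(multivariateGaussian 0 S) = 0 := by
  rw [integral_inner (f := fun z => z) (IsGaussian.memLp_two_id.integrable one_le_two) x,
    integral_id_multivariateGaussian, inner_zero_right]

theorem isCentredIsotropic_multivariateGaussian {ι : Type*} [Fintype ι] [DecidableEq ι] {r : ℝ}
    (hr : 0 ≤ r) :
    IsCentredIsotropic (multivariateGaussian 0 (r • (1 : Matrix ι ι ℝ))) r where
  memLp_two := IsGaussian.memLp_two_id
  integral_inner := integral_inner_multivariateGaussian_zero _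
  integral_inner_sq x := by
    have hid : MemLp id 2 (multivariateGaussian 0 (r • (1 : Matrix ι ι ℝ))) :=
      IsGaussian.memLp_two_id
    rw [← variance_of_integral_eq_zero (X := fun z => inner ℝ x z)
        (hid.const_inner x).aemeasurable (integral_inner_multivariateGaussian_zero _ x),
      ← covarianceBilin_self hid, covarianceBilin_multivariateGaussian
        (Matrix.PosSemidef.one.smul hr), Matrix.smul_mulVec, Matrix.one_mulVec, dotProduct_smul,
      smul_eq_mul, EuclideanSpace.real_norm_sq_eq]
    simp only [dotProduct, sq]

section Moments

variable {E : Type*} [NormedAddCommGroup E] [InnerProductSpace ℝ E] [MeasurableSpace E]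
  {μ : Measure E} [IsProbabilityMeasure μ] {r : ℝ}

theorem IsCentredIsotropic.integrable_sq_add_inner (hμ : IsCentredIsotropic μ r) (b : ℝ) (x : E) :
    Integrable (fun z => (b + inner ℝ x z) ^ 2) μ :=
  ((memLp_const b).add (hμ.memLp_two.const_inner x)).integrable_sq

theorem IsCentredIsotropic.integral_sq_add_inner (hμ : IsCentredIsotropic μ r) (b : ℝ)
    (x : E) : ∫ z, (b + inner ℝ x z) ^ 2 ∂μ = b ^ 2 + r * ‖x‖ ^ 2 := by
  have hL : MemLp (fun z => inner ℝ x z) 2 μ := hμ.memLp_two.const_inner x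
  have hint : Integrable (fun z => 2 * b * inner ℝ x z) μ :=
    (hL.integrable one_le_two).const_mul _
  have hlin : Integrable (fun z => b ^ 2 + 2 * b * inner ℝ x z) μ :=
    (integrable_const _).add hint
  simp_rw [add_sq]
  rw [integral_add hlin hL.integrable_sq, integral_add (integrable_const _) hint,
    integral_const_mul, hμ.integral_inner, hμ.integral_inner_sq]
  simp

end Moments

variable {ι κ : Type*} [Fintype ι] [Fintype κ]

theorem frobenius_norm_sq_eq_sum (A : Matrix ι κ ℝ) : ‖A‖ ^ 2 = ∑ i, ∑ j, A i j ^ 2 := by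
  rw [Matrix.frobenius_norm_def, ← Real.sqrt_eq_rpow, Real.sq_sqrt (by positivity)]
  simp only [Real.rpow_ofNat, Real.norm_eq_abs, sq_abs]

variable [DecidableEq κ]

theorem norm_sq_add_toEuclideanLin (b : EuclideanSpace ℝ ι) (A : Matrix ι κ ℝ)
    (z : EuclideanSpace ℝ κ) :
    ‖b + Matrix.toEuclideanLin A z‖ ^ 2
      = ∑ i, (b i + inner ℝ (WithLp.toLp 2 (A i) : EuclideanSpace ℝ κ) z) ^ 2 := by
  rw [EuclideanSpace.real_norm_sq_eq]
  refine Finset.sum_congr rfl fun i _ => ?_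
  simp [PiLp.inner_apply, Matrix.mulVec, dotProduct, mul_comm, Matrix.toLpLin_apply]

theorem measurable_toEuclideanLin_apply {X ι : Type*} {_ : MeasurableSpace X} {A : X → Matrix ι κ ℝ}
    {z : X → EuclideanSpace ℝ κ} (hA : ∀ i j, Measurable fun x => A x i j) (hz : Measurable z) :
    Measurable fun x => Matrix.toEuclideanLin (A x) (z x) := by
  refine (WithLp.measurable_toLp 2 (ι → ℝ)).comp (measurable_pi_lambda _ fun i => ?_)
  change Measurable fun x => ∑ j, A x i j * z x j
  fun_prop

theorem IsCentredIsotropic.lintegral_norm_sq_add_toEuclideanLin {μ : Measure (EuclideanSpace ℝ κ)}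
    [IsProbabilityMeasure μ] {r : ℝ} (hμ : IsCentredIsotropic μ r) (b : EuclideanSpace ℝ ι)
    (A : Matrix ι κ ℝ) :
    ∫⁻ z, ENNReal.ofReal (‖b + Matrix.toEuclideanLin A z‖ ^ 2) ∂μ
      = ENNReal.ofReal (‖b‖ ^ 2 + r * ‖A‖ ^ 2) := by
  simp_rw [norm_sq_add_toEuclideanLin]
  rw [← ofReal_integral_eq_lintegral_ofReal
      (integrable_finsetSum _ fun i _ => hμ.integrable_sq_add_inner _ _)
      (ae_of_all _ fun z => by positivity),
    integral_finsetSum _ fun i _ => hμ.integrable_sq_add_inner _ _]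
  simp only [hμ.integral_sq_add_inner, EuclideanSpace.real_norm_sq_eq, frobenius_norm_sq_eq_sum,
    Finset.sum_add_distrib, Finset.mul_sum]

theorem setLIntegral_norm_sq_add_toEuclideanLin_of_indep {Ω : Type*} {mΩ : MeasurableSpace Ω}
    {P : Measure Ω} [IsProbabilityMeasure P] {𝓖 : MeasurableSpace Ω} (h𝓖 : 𝓖 ≤ mΩ)
    {Z : Ω → EuclideanSpace ℝ κ} (hZ : Measurable[mΩ] Z)
    (hind : Indep 𝓖 (MeasurableSpace.comap Z inferInstance) P) {r : ℝ}
    (hr : IsCentredIsotropic (@Measure.map _ _ mΩ _ Z P) r) {b : Ω → EuclideanSpace ℝ ι}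
    (hb : Measurable[𝓖] b) {A : Ω → Matrix ι κ ℝ} (hA : ∀ i j, Measurable[𝓖] fun ω => A ω i j)
    {S : Set Ω} (hS : MeasurableSet[𝓖] S) :
    ∫⁻ ω in S, ENNReal.ofReal (‖b ω + Matrix.toEuclideanLin (A ω) (Z ω)‖ ^ 2) ∂P
      = ∫⁻ ω in S, ENNReal.ofReal (‖b ω‖ ^ 2 + r * ‖A ω‖ ^ 2) ∂P := by
  have : IsProbabilityMeasure (@Measure.map _ _ mΩ _ Z P) :=
    Measure.isProbabilityMeasure_map hZ.aemeasurable
  have hF : Measurable[𝓖.prod inferInstance] fun p : Ω × EuclideanSpace ℝ κ =>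
      ENNReal.ofReal (‖b p.1 + Matrix.toEuclideanLin (A p.1) p.2‖ ^ 2) := by
    simp_rw [norm_sq_add_toEuclideanLin, PiLp.inner_apply]
    fun_prop
  rw [setLIntegral_comp_of_indep h𝓖 hZ hind hF hS]
  simp only [hr.lintegral_norm_sq_add_toEuclideanLin]

end IsotropicNoise

section Increments

variable {Ω : Type*} [MeasurableSpace Ω] {P : Measure Ω} {m : ℕ}
  {W : ℝ≥0 → Ω → EuclideanSpace ℝ (Fin m)}

/-- The properties of a Brownian motion that the scheme sees through second moments: the
increments over disjoint intervals are independent, and those over `[s, t]` are centred with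
covariance `(t - s)` times the identity. -/
structure HasIsotropicIncrements (W : ℝ≥0 → Ω → EuclideanSpace ℝ (Fin m)) (P : Measure Ω) :
    Prop where
  measurable : ∀ t, Measurable (W t)
  indep_increments : HasIndepIncrements W P
  isotropic : ∀ s t : ℝ≥0, s ≤ t →
    IsCentredIsotropic (P.map fun ω => W t ω - W s ω) ((t : ℝ) - s)

theorem IsBrownianMotion.hasIsotropicIncrements (hW : IsBrownianMotion W P) :
    HasIsotropicIncrements W P where
  measurable := hW.measurable
  indep_increments := hW.indep_increments
  isotropic s t hst := by
    rw [(hW.law_increments s t hst).map_eq]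
    exact isCentredIsotropic_multivariateGaussian (sub_nonneg.2 (NNReal.coe_le_coe.2 hst))

namespace HasIsotropicIncrements

variable {τ : ℝ}

theorem measurable_pathIncrement (hW : HasIsotropicIncrements W P) (τ : ℝ) (N : ℕ+) (k : ℤ) :
    Measurable fun ω => pathIncrement τ N (fun t => W t ω) k :=
  (hW.measurable _).sub (hW.measurable _)

theorem iIndepFun_pathIncrement (hW : HasIsotropicIncrements W P) (hτ : 0 < τ) (N : ℕ+) :
    iIndepFun (fun (k : ℕ) ω => pathIncrement τ N (fun t => W t ω) k) P := by
  have hΔ := stepSize_pos hτ N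
  have hgrid : Monotone fun k : ℕ => Real.toNNReal ((k : ℝ) * stepSize τ N) :=
    fun i j hij => Real.toNNReal_le_toNNReal (by gcongr)
  simpa [pathIncrement] using hW.indep_increments.nat hgrid

theorem isotropic_pathIncrement (hW : HasIsotropicIncrements W P) (hτ : 0 < τ) (N : ℕ+) (k : ℕ) :
    IsCentredIsotropic (P.map fun ω => pathIncrement τ N (fun t => W t ω) k) (stepSize τ N) := by
  have hΔ := stepSize_pos hτ N
  have h := hW.isotropic (Real.toNNReal ((k : ℝ) * stepSize τ N))
    (Real.toNNReal (((k : ℝ) + 1) * stepSize τ N))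
    (Real.toNNReal_le_toNNReal (by gcongr; linarith))
  rwa [Real.coe_toNNReal _ (by positivity), Real.coe_toNNReal _ (by positivity), ← sub_mul,
    add_sub_cancel_left, one_mul] at h

end HasIsotropicIncrements

end Increments

section Coefficients

theorem continuous_of_forall_norm_sub_le_on_balls {E F : Type*} [SeminormedAddCommGroup E]
    [SeminormedAddCommGroup F] {h : E → F}
    (hh : ∀ R, 1 ≤ R → ∃ l, ∀ p q, ‖p‖ ≤ R → ‖q‖ ≤ R → ‖h p - h q‖ ≤ l * ‖p - q‖) :
    Continuous h := by
  rw [continuous_iff_continuousAt]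
  intro p
  obtain ⟨l, hl⟩ := hh (‖p‖ + 1) (le_add_of_nonneg_left (norm_nonneg p))
  have hlip : LipschitzOnWith l.toNNReal h (Metric.ball 0 (‖p‖ + 1)) :=
    LipschitzOnWith.of_dist_le' fun a ha b hb => by
      rw [dist_eq_norm, dist_eq_norm]
      exact hl a b (mem_ball_zero_iff.1 ha).le (mem_ball_zero_iff.1 hb).le
  exact hlip.continuousOn.continuousAt
    (Metric.isOpen_ball.mem_nhds (mem_ball_zero_iff.2 (lt_add_one _)))

theorem sq_le_one_add_rpow {x α : ℝ} (hx : 0 ≤ x) (hα : 2 ≤ α) : x ^ 2 ≤ 1 + x ^ α := by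
  rcases le_total x 1 with h | h
  · exact (pow_le_one₀ hx h).trans (le_add_of_nonneg_right (Real.rpow_nonneg hx α))
  · rw [← Real.rpow_two]
    exact (Real.rpow_le_rpow_of_exponent_le h hα).trans (le_add_of_nonneg_left zero_le_one)

variable {d m : ℕ}
  {f : EuclideanSpace ℝ (Fin d) → EuclideanSpace ℝ (Fin d) → EuclideanSpace ℝ (Fin d)}
  {g : EuclideanSpace ℝ (Fin d) → EuclideanSpace ℝ (Fin d) → Matrix (Fin d) (Fin m) ℝ}
  {Φ : Set.Ici (1 : ℝ) → ℝ≥0} {ν Δ : ℝ}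

theorem norm_truncMap (ν Δ : ℝ) (x : EuclideanSpace ℝ (Fin d)) :
    ‖truncMap f g Φ ν Δ x‖ = min ‖x‖ (truncRadius f g Φ ν Δ : ℝ) := by
  have hr : (0 : ℝ) ≤ (truncRadius f g Φ ν Δ : ℝ) :=
    zero_le_one.trans (truncRadius f g Φ ν Δ).2
  by_cases hx : x = 0
  · simp [hx, truncMap, hr]
  · rw [truncMap, norm_smul, norm_smul, norm_inv, norm_norm,
      inv_mul_cancel₀ (norm_ne_zero_iff.2 hx), mul_one,
      Real.norm_of_nonneg (le_min (norm_nonneg _) hr)]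

theorem norm_truncMap_le (ν Δ : ℝ) (x : EuclideanSpace ℝ (Fin d)) :
    ‖truncMap f g Φ ν Δ x‖ ≤ ‖x‖ :=
  (norm_truncMap ν Δ x).trans_le (min_le_left _ _)

theorem norm_truncMap_le_truncRadius (ν Δ : ℝ) (x : EuclideanSpace ℝ (Fin d)) :
    ‖truncMap f g Φ ν Δ x‖ ≤ truncRadius f g Φ ν Δ :=
  (norm_truncMap ν Δ x).trans_le (min_le_right _ _)

theorem one_le_truncConst : 1 ≤ truncConst f g Φ := by
  simp [truncConst]

theorem growth_one_le_truncConst : Φ ⟨1, Set.self_mem_Ici⟩ ≤ truncConst f g Φ := by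
  simp [truncConst]

theorem norm_drift_zero_le_truncConst : ‖f 0 0‖ ≤ truncConst f g Φ := by
  simp [truncConst]

theorem truncConst_le_mul_rpow (hν : 0 ≤ ν) (hΔ : 0 < Δ) (hΔ' : Δ ≤ 1) :
    truncConst f g Φ ≤ truncConst f g Φ * Δ ^ (-ν) :=
  le_mul_of_one_le_right (zero_le_one.trans one_le_truncConst)
    (Real.one_le_rpow_of_pos_of_le_one_of_nonpos hΔ hΔ' (neg_nonpos.2 hν))

theorem eq_and_eq_of_norm_sub_add_min_eq_zero {E : Type*} [NormedAddCommGroup E] {x x' y y' : E}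
    (h : ‖x - x'‖ + min 1 ‖y - y'‖ = 0) : x = x' ∧ y = y' := by
  have hmin : 0 ≤ min 1 ‖y - y'‖ := le_min zero_le_one (norm_nonneg _)
  obtain ⟨hx, hy⟩ := (add_eq_zero_iff_of_nonneg (norm_nonneg _) hmin).1 h
  refine ⟨sub_eq_zero.1 (norm_eq_zero.1 hx), sub_eq_zero.1 (norm_eq_zero.1 ?_)⟩
  rcases min_choice 1 ‖y - y'‖ with h1 | h1 <;> rw [h1] at hy
  exacts [absurd hy one_ne_zero, hy]

namespace IsGrowthControl

theorem norm_sub_le (hΦ : IsGrowthControl f g Φ) {R : Set.Ici (1 : ℝ)}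
    {x x' y y' : EuclideanSpace ℝ (Fin d)} (hx : ‖x‖ ≤ R) (hx' : ‖x'‖ ≤ R) (hy : ‖y‖ ≤ R)
    (hy' : ‖y'‖ ≤ R) :
    ‖f x y - f x' y'‖ ≤ Φ R * (‖x - x'‖ + min 1 ‖y - y'‖) ∧
      ‖g x y - g x' y'‖ ^ 2 ≤ Φ R * (‖x - x'‖ + min 1 ‖y - y'‖) ^ 2 := by
  have hb := hΦ.bound R x x' y y' hx hx' hy hy'
  have hδ : 0 ≤ ‖x - x'‖ + min 1 ‖y - y'‖ := by positivity
  rcases hδ.eq_or_lt with h0 | hpos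
  · obtain ⟨rfl, rfl⟩ := eq_and_eq_of_norm_sub_add_min_eq_zero h0.symm
    simp
  · rw [← div_le_iff₀ hpos, ← div_le_iff₀ (by positivity)]
    exact ⟨le_trans (le_add_of_nonneg_right (by positivity)) hb,
      le_trans (le_add_of_nonneg_left (by positivity)) hb⟩

theorem norm_sub_le_prod (hΦ : IsGrowthControl f g Φ) {R : Set.Ici (1 : ℝ)}
    {p q : EuclideanSpace ℝ (Fin d) × EuclideanSpace ℝ (Fin d)} (hp : ‖p‖ ≤ R) (hq : ‖q‖ ≤ R) :
    ‖f p.1 p.2 - f q.1 q.2‖ ≤ Φ R * (2 * ‖p - q‖) ∧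
      ‖g p.1 p.2 - g q.1 q.2‖ ^ 2 ≤ Φ R * (2 * ‖p - q‖) ^ 2 := by
  have hδ : ‖p.1 - q.1‖ + min 1 ‖p.2 - q.2‖ ≤ 2 * ‖p - q‖ := by
    rw [two_mul]
    exact add_le_add (norm_fst_le (p - q)) ((min_le_right _ _).trans (norm_snd_le (p - q)))
  obtain ⟨hf, hg⟩ := hΦ.norm_sub_le ((norm_fst_le p).trans hp) ((norm_fst_le q).trans hq)
    ((norm_snd_le p).trans hp) ((norm_snd_le q).trans hq)
  exact ⟨hf.trans (by gcongr), hg.trans (by gcongr)⟩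

theorem continuous_drift (hΦ : IsGrowthControl f g Φ) : Continuous (Function.uncurry f) :=
  continuous_of_forall_norm_sub_le_on_balls fun R hR => ⟨Φ ⟨R, hR⟩ * 2, fun _ _ hp hq =>
    (hΦ.norm_sub_le_prod (R := ⟨R, hR⟩) hp hq).1.trans_eq (mul_assoc _ _ _).symm⟩

theorem continuous_diffusion (hΦ : IsGrowthControl f g Φ) : Continuous (Function.uncurry g) :=
  continuous_of_forall_norm_sub_le_on_balls fun R hR => ⟨√(Φ ⟨R, hR⟩) * 2, fun p q hp hq => by
    refine le_of_sq_le_sq ?_ (by positivity)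
    rw [mul_assoc, mul_pow, Real.sq_sqrt (NNReal.coe_nonneg _)]
    exact (hΦ.norm_sub_le_prod (R := ⟨R, hR⟩) hp hq).2⟩

theorem continuous_diffusion_apply (hΦ : IsGrowthControl f g Φ) (i : Fin d) (j : Fin m) :
    Continuous fun p : EuclideanSpace ℝ (Fin d) × EuclideanSpace ℝ (Fin d) => g p.1 p.2 i j :=
  (Matrix.entryLinearMap ℝ ℝ i j).continuous_of_finiteDimensional.comp hΦ.continuous_diffusion

theorem apply_truncRadius (hΦ : IsGrowthControl f g Φ) (hν : 0 ≤ ν) (hΔ : 0 < Δ) (hΔ' : Δ ≤ 1) :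
    (Φ (truncRadius f g Φ ν Δ) : ℝ) = truncConst f g Φ * Δ ^ (-ν) := by
  have hK : truncConst f g Φ ≤ truncConst f g Φ * Δ ^ (-ν) :=
    truncConst_le_mul_rpow hν hΔ hΔ'
  have hcoe := Real.coe_toNNReal _ (zero_le_one.trans (one_le_truncConst.trans hK))
  have hmem : Real.toNNReal (truncConst f g Φ * Δ ^ (-ν)) ∈ Set.range Φ := by
    have : PreconnectedSpace (Set.Ici (1 : ℝ)) := Subtype.preconnectedSpace isPreconnected_Ici
    refine mem_range_of_exists_le_of_exists_ge hΦ.continuous ⟨⟨1, Set.self_mem_Ici⟩, ?_⟩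
      (hΦ.tendsto.eventually_ge_atTop _).exists
    rw [← NNReal.coe_le_coe, hcoe]
    exact growth_one_le_truncConst.trans hK
  rw [truncRadius, Function.invFun_eq hmem, hcoe]

theorem norm_drift_le (hΦ : IsGrowthControl f g Φ) (hν : 0 ≤ ν) (hΔ : 0 < Δ) (hΔ' : Δ ≤ 1)
    {x y : EuclideanSpace ℝ (Fin d)} (hx : ‖x‖ ≤ truncRadius f g Φ ν Δ)
    (hy : ‖y‖ ≤ truncRadius f g Φ ν Δ) :
    ‖f x y‖ ≤ truncConst f g Φ * Δ ^ (-ν) * (2 + ‖x‖) := by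
  have h0 : ‖(0 : EuclideanSpace ℝ (Fin d))‖ ≤ truncRadius f g Φ ν Δ := by
    simpa using zero_le_one.trans (truncRadius f g Φ ν Δ).2
  have hK : truncConst f g Φ ≤ truncConst f g Φ * Δ ^ (-ν) :=
    truncConst_le_mul_rpow hν hΔ hΔ'
  have hsub := (hΦ.norm_sub_le hx h0 hy h0).1
  rw [hΦ.apply_truncRadius hν hΔ hΔ', sub_zero, sub_zero] at hsub
  set L := truncConst f g Φ * Δ ^ (-ν)
  have hL : 0 ≤ L := zero_le_one.trans (one_le_truncConst.trans hK)
  calc ‖f x y‖ ≤ ‖f 0 0‖ + ‖f x y - f 0 0‖ := norm_le_norm_add_norm_sub' _ _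
    _ ≤ L + L * (‖x‖ + 1) := by
        gcongr
        · exact norm_drift_zero_le_truncConst.trans hK
        · exact hsub.trans (by gcongr; exact min_le_left _ _)
    _ = L * (2 + ‖x‖) := by ring

theorem norm_drift_sq_le (hΦ : IsGrowthControl f g Φ) (hν : 0 ≤ ν) (hΔ : 0 < Δ) (hΔ' : Δ ≤ 1)
    {x y : EuclideanSpace ℝ (Fin d)} (hx : ‖x‖ ≤ truncRadius f g Φ ν Δ)
    (hy : ‖y‖ ≤ truncRadius f g Φ ν Δ) :
    ‖f x y‖ ^ 2 ≤ 6 * truncConst f g Φ ^ 2 * Δ ^ (-(2 * ν)) * (1 + ‖x‖ ^ 2) := by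
  have hpow : Δ ^ (-(2 * ν)) = (Δ ^ (-ν)) ^ 2 := by
    rw [← Real.rpow_mul_natCast hΔ.le]
    congr 1
    push_cast
    ring
  calc ‖f x y‖ ^ 2 ≤ (truncConst f g Φ * Δ ^ (-ν) * (2 + ‖x‖)) ^ 2 := by
        gcongr
        exact hΦ.norm_drift_le hν hΔ hΔ' hx hy
    _ = truncConst f g Φ ^ 2 * Δ ^ (-(2 * ν)) * (2 + ‖x‖) ^ 2 := by rw [hpow]; ring
    _ ≤ truncConst f g Φ ^ 2 * Δ ^ (-(2 * ν)) * (6 * (1 + ‖x‖ ^ 2)) := by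
        gcongr
        nlinarith [sq_nonneg (‖x‖ - 1)]
    _ = 6 * truncConst f g Φ ^ 2 * Δ ^ (-(2 * ν)) * (1 + ‖x‖ ^ 2) := by ring

theorem mul_norm_drift_sq_le (hΦ : IsGrowthControl f g Φ) (hν : ν ∈ Set.Icc 0 (1 / 2))
    {Δ₁ : ℝ} (hΔ : 0 < Δ) (hΔΔ₁ : Δ ≤ Δ₁) (hΔ₁ : Δ₁ ≤ 1) {α : ℝ} (hα : 2 ≤ α)
    {x y : EuclideanSpace ℝ (Fin d)} (hx : ‖x‖ ≤ truncRadius f g Φ ν Δ)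
    (hy : ‖y‖ ≤ truncRadius f g Φ ν Δ) :
    Δ * ‖f x y‖ ^ 2 ≤ 6 * truncConst f g Φ ^ 2 * Δ₁ ^ (1 - 2 * ν) * (2 + ‖x‖ ^ α) := by
  have hpow : Δ * Δ ^ (-(2 * ν)) = Δ ^ (1 - 2 * ν) := by
    rw [sub_eq_add_neg, Real.rpow_add hΔ, Real.rpow_one]
  have hsq : 1 + ‖x‖ ^ 2 ≤ 2 + ‖x‖ ^ α := by linarith [sq_le_one_add_rpow (norm_nonneg x) hα]
  calc Δ * ‖f x y‖ ^ 2
      ≤ Δ * (6 * truncConst f g Φ ^ 2 * Δ ^ (-(2 * ν)) * (1 + ‖x‖ ^ 2)) := by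
        gcongr
        exact hΦ.norm_drift_sq_le hν.1 hΔ (hΔΔ₁.trans hΔ₁) hx hy
    _ = 6 * truncConst f g Φ ^ 2 * Δ ^ (1 - 2 * ν) * (1 + ‖x‖ ^ 2) := by rw [← hpow]; ring
    _ ≤ 6 * truncConst f g Φ ^ 2 * Δ₁ ^ (1 - 2 * ν) * (2 + ‖x‖ ^ α) := by
        gcongr
        · exact mul_nonneg (by positivity) (Real.rpow_nonneg (hΔ.le.trans hΔΔ₁) _)
        · linarith [hν.2]

end IsGrowthControl

/-- The dissipativity of a single Euler step: for states of norm at most `R`, the mean square of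
`x + Δ f(x, y) + g(x, y) Z`, with `Z` centred of covariance `Δ` times the identity, is bounded as
the dissipativity condition suggests. -/
def StepDissipative
    (f : EuclideanSpace ℝ (Fin d) → EuclideanSpace ℝ (Fin d) → EuclideanSpace ℝ (Fin d))
    (g : EuclideanSpace ℝ (Fin d) → EuclideanSpace ℝ (Fin d) → Matrix (Fin d) (Fin m) ℝ)
    (α C b a Δ R : ℝ) : Prop :=
  ∀ x y : EuclideanSpace ℝ (Fin d), ‖x‖ ≤ R → ‖y‖ ≤ R →
    ‖x + Δ • f x y‖ ^ 2 + Δ * ‖g x y‖ ^ 2 ≤ ‖x‖ ^ 2 + Δ * (C - b * ‖x‖ ^ α + a * ‖y‖ ^ α)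

theorem Dissipative.stepDissipative {α a₁ a₂ a₃ : ℝ} (hH : Dissipative f g α a₁ a₂ a₃)
    (hΦ : IsGrowthControl f g Φ) (hν : ν ∈ Set.Icc 0 (1 / 2)) {Δ₁ : ℝ} (hΔ : 0 < Δ)
    (hΔΔ₁ : Δ ≤ Δ₁) (hΔ₁ : Δ₁ ≤ 1) :
    StepDissipative f g α (a₁ + 2 * (6 * truncConst f g Φ ^ 2 * Δ₁ ^ (1 - 2 * ν)))
      (a₂ - 6 * truncConst f g Φ ^ 2 * Δ₁ ^ (1 - 2 * ν)) a₃ Δ (truncRadius f g Φ ν Δ) := by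
  intro x y hx hy
  have hdrift := hΦ.mul_norm_drift_sq_le hν hΔ hΔΔ₁ hΔ₁ hH.two_le hx hy
  have hbound := hH.bound x y
  rw [real_inner_smul_left] at hbound
  have hexpand : ‖x + Δ • f x y‖ ^ 2
      = ‖x‖ ^ 2 + Δ * (2 * inner ℝ x (f x y) + Δ * ‖f x y‖ ^ 2) := by
    rw [norm_add_sq_real, real_inner_smul_right, norm_smul, Real.norm_of_nonneg hΔ.le]
    ring
  calc ‖x + Δ • f x y‖ ^ 2 + Δ * ‖g x y‖ ^ 2
      = ‖x‖ ^ 2 + Δ * (2 * inner ℝ x (f x y) + ‖g x y‖ ^ 2 + Δ * ‖f x y‖ ^ 2) := by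
        rw [hexpand]; ring
    _ ≤ _ := by
        gcongr ‖x‖ ^ 2 + Δ * ?_
        linarith

end Coefficients

section Lyapunov

/-- The delayed part of the Lyapunov functional at time `k`: the past values
`v (k - 1), …, v (k - N)`, with weights decreasing linearly from `c` towards `a`. -/
noncomputable def delaySum (c a : ℝ) (N : ℕ) (v : ℤ → ℝ) (k : ℤ) : ℝ :=
  ∑ i ∈ Finset.range N, (c - (c - a) / N * i) * v (k - 1 - i)

variable {τ c a Δ : ℝ} {N : ℕ} {v : ℤ → ℝ}

theorem delaySum_nonneg (ha : 0 ≤ a) (hac : a ≤ c) (hv : ∀ j, 0 ≤ v j) (k : ℤ) :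
    0 ≤ delaySum c a N v k := by
  refine Finset.sum_nonneg fun i hi => mul_nonneg ?_ (hv _)
  have hi' : (i : ℝ) ≤ N := by exact_mod_cast (Finset.mem_range.1 hi).le
  calc 0 ≤ a := ha
    _ = c - (c - a) * 1 := by ring
    _ ≤ c - (c - a) * (i / N) := by
        gcongr
        exact div_le_one_of_le₀ hi' N.cast_nonneg
    _ = c - (c - a) / N * i := by ring

theorem delaySum_le (hac : a ≤ c) (hv : ∀ j, 0 ≤ v j) (k : ℤ) :
    delaySum c a N v k ≤ c * ∑ i ∈ Finset.range N, v (k - 1 - i) := by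
  rw [delaySum, Finset.mul_sum]
  have := sub_nonneg.2 hac
  exact Finset.sum_le_sum fun i _ =>
    mul_le_mul_of_nonneg_right (sub_le_self c (by positivity)) (hv _)

theorem delaySum_succ (hN : N ≠ 0) (v : ℤ → ℝ) (k : ℤ) :
    delaySum c a N v (k + 1) + a * v (k - N)
      = c * v k + delaySum c a N v k - (c - a) / N * ∑ i ∈ Finset.range N, v (k - 1 - i) := by
  have hN' : (N : ℝ) ≠ 0 := Nat.cast_ne_zero.2 hN
  have hlast : delaySum c a N v (k + 1) + a * v (k - N)
      = ∑ i ∈ Finset.range (N + 1), (c - (c - a) / N * i) * v (k - i) := by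
    rw [Finset.sum_range_succ, div_mul_cancel₀ _ hN', delaySum]
    simp
  have hshift : ∀ i : ℕ, k - ((i + 1 : ℕ) : ℤ) = k - 1 - i := fun i => by push_cast; ring
  rw [hlast, Finset.sum_range_succ', delaySum, Finset.mul_sum, add_sub_assoc,
    ← Finset.sum_sub_distrib, add_comm]
  simp only [hshift, Nat.cast_zero, mul_zero, sub_zero]
  congr 1
  refine Finset.sum_congr rfl fun i _ => ?_
  push_cast
  ring

/-- The constant `κ` is an admissible decay rate for the Lyapunov functional with weights between
`a` and `c`, delay `τ` and dissipation `b`. -/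
structure IsDecayRate (τ a b c κ : ℝ) : Prop where
  nonneg : 0 ≤ a
  lt : a < c
  pos : 0 < κ
  le_one : κ ≤ 1
  le_sub : κ ≤ b - c
  mul_le : κ * (τ * c) ≤ c - a

theorem exists_isDecayRate {a b : ℝ} (hτ : 0 < τ) (ha : 0 ≤ a) (hab : a < b) :
    ∃ c κ, IsDecayRate τ a b c κ := by
  obtain ⟨c, hac, hcb⟩ := exists_between hab
  have hτc : 0 < τ * c := mul_pos hτ (ha.trans_lt hac)
  refine ⟨c, min 1 (min (b - c) ((c - a) / (τ * c))), ha, hac, ?_, min_le_left _ _,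
    (min_le_right _ _).trans (min_le_left _ _), ?_⟩
  · exact lt_min one_pos (lt_min (sub_pos.2 hcb) (div_pos (sub_pos.2 hac) hτc))
  · exact (le_div_iff₀ hτc).1 ((min_le_right _ _).trans (min_le_right _ _))

variable {b κ : ℝ}

theorem IsDecayRate.mul_delaySum_le (hκ : IsDecayRate τ a b c κ) (hN : N ≠ 0) (hΔN : Δ * N = τ)
    (hΔ : 0 ≤ Δ) (hv : ∀ j, 0 ≤ v j) (k : ℤ) :
    κ * (Δ * delaySum c a N v k) ≤ (c - a) / N * ∑ i ∈ Finset.range N, v (k - 1 - i) := by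
  have : (0 : ℝ) < N := Nat.cast_pos.2 (Nat.pos_of_ne_zero hN)
  have hκ0 := hκ.pos.le
  have hsum : 0 ≤ ∑ i ∈ Finset.range N, v (k - 1 - i) := Finset.sum_nonneg fun i _ => hv _
  calc κ * (Δ * delaySum c a N v k)
      ≤ κ * (Δ * (c * ∑ i ∈ Finset.range N, v (k - 1 - i))) := by
        gcongr
        exact delaySum_le hκ.lt.le hv k
    _ = κ * (τ * c) / N * ∑ i ∈ Finset.range N, v (k - 1 - i) := by
        rw [← hΔN]
        field_simp
    _ ≤ (c - a) / N * ∑ i ∈ Finset.range N, v (k - 1 - i) := by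
        gcongr
        exact hκ.mul_le

variable {E : Type*} [NormedAddCommGroup E] {α : ℝ} {x : ℤ → E}

/-- The Lyapunov functional of a trajectory `x` with step size `Δ` and delay `N Δ`. -/
noncomputable def lyapunov (α c a Δ : ℝ) (N : ℕ) (x : ℤ → E) (k : ℤ) : ℝ :=
  ‖x k‖ ^ 2 + Δ * delaySum c a N (fun j => ‖x j‖ ^ α) k

theorem sq_le_lyapunov (ha : 0 ≤ a) (hac : a ≤ c) (hΔ : 0 ≤ Δ) (k : ℤ) :
    ‖x k‖ ^ 2 ≤ lyapunov α c a Δ N x k :=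
  le_add_of_nonneg_right <| mul_nonneg hΔ <|
    delaySum_nonneg ha hac (fun _ => Real.rpow_nonneg (norm_nonneg _) _) k

theorem lyapunov_le {M : ℝ} (hα : 0 ≤ α) (hc : 0 ≤ c) (hac : a ≤ c) (hΔ : 0 ≤ Δ) {k : ℤ}
    (hx : ∀ j ≤ k, ‖x j‖ ≤ M) : lyapunov α c a Δ N x k ≤ M ^ 2 + Δ * N * c * M ^ α := by
  have hsum : ∑ i ∈ Finset.range N, ‖x (k - 1 - i)‖ ^ α ≤ N * M ^ α := by
    simpa using Finset.sum_le_card_nsmul (Finset.range N) (fun i : ℕ => ‖x (k - 1 - i)‖ ^ α) (M ^ α)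
      fun i _ => Real.rpow_le_rpow (norm_nonneg _) (hx _ (by omega)) hα
  calc lyapunov α c a Δ N x k ≤ M ^ 2 + Δ * (c * (N * M ^ α)) := by
        rw [lyapunov]
        gcongr
        · exact hx k le_rfl
        · exact (delaySum_le hac (fun _ => Real.rpow_nonneg (norm_nonneg _) _) k).trans
            (mul_le_mul_of_nonneg_left hsum hc)
    _ = M ^ 2 + Δ * N * c * M ^ α := by ring

theorem measurable_delaySum_norm_rpow [MeasurableSpace E] [OpensMeasurableSpace E] {X : Type*}
    {_ : MeasurableSpace X} {x : X → ℤ → E} {k : ℤ} (hx : ∀ j < k, Measurable fun p => x p j) :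
    Measurable fun p => delaySum c a N (fun j => ‖x p j‖ ^ α) k :=
  Finset.measurable_fun_sum _ fun _ _ => ((hx _ (by omega)).norm.pow_const α).const_mul _

theorem measurable_lyapunov [MeasurableSpace E] [OpensMeasurableSpace E] {X : Type*}
    {_ : MeasurableSpace X} {x : X → ℤ → E} {k : ℤ} (hx : ∀ j ≤ k, Measurable fun p => x p j) :
    Measurable fun p => lyapunov α c a Δ N (x p) k :=
  ((hx k le_rfl).norm.pow_const 2).add
    ((measurable_delaySum_norm_rpow fun j hj => hx j hj.le).const_mul Δ)

theorem IsDecayRate.mul_sq_sub_one_le (hκ : IsDecayRate τ a b c κ) (hα : 2 ≤ α) (x : E) :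
    κ * (‖x‖ ^ 2 - 1) ≤ (b - c) * ‖x‖ ^ α :=
  calc κ * (‖x‖ ^ 2 - 1) ≤ κ * ‖x‖ ^ α := by
        have := hκ.pos.le
        gcongr
        linarith [sq_le_one_add_rpow (norm_nonneg x) hα]
    _ ≤ (b - c) * ‖x‖ ^ α := by
        gcongr
        exact hκ.le_sub

theorem IsDecayRate.add_delaySum_succ_le (hκ : IsDecayRate τ a b c κ) (hα : 2 ≤ α) (hN : N ≠ 0)
    (hΔN : Δ * N = τ) (hΔ : 0 ≤ Δ) {p C : ℝ} {k : ℤ}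
    (hp : p ≤ ‖x k‖ ^ 2 + Δ * (C - b * ‖x k‖ ^ α + a * ‖x (k - N)‖ ^ α)) :
    p + Δ * delaySum c a N (fun j => ‖x j‖ ^ α) (k + 1)
      ≤ (1 - κ * Δ) * lyapunov α c a Δ N x k + Δ * (C + κ) := by
  have hsucc := delaySum_succ (c := c) (a := a) hN (fun j => ‖x j‖ ^ α) k
  have hdelay := hκ.mul_delaySum_le hN hΔN hΔ (v := fun j => ‖x j‖ ^ α)
    (fun _ => Real.rpow_nonneg (norm_nonneg _) _) k
  set T := ∑ i ∈ Finset.range N, ‖x (k - 1 - i)‖ ^ α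
  set S := delaySum c a N (fun j => ‖x j‖ ^ α) k
  calc p + Δ * delaySum c a N (fun j => ‖x j‖ ^ α) (k + 1)
      ≤ ‖x k‖ ^ 2 + Δ * (C - b * ‖x k‖ ^ α + a * ‖x (k - N)‖ ^ α)
          + Δ * delaySum c a N (fun j => ‖x j‖ ^ α) (k + 1) := by gcongr
    _ = ‖x k‖ ^ 2 + Δ * (C + S - (b - c) * ‖x k‖ ^ α - (c - a) / N * T) := by
        linear_combination Δ * hsucc
    _ ≤ ‖x k‖ ^ 2 + Δ * (C + S - κ * (‖x k‖ ^ 2 - 1) - κ * (Δ * S)) := by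
        gcongr ‖x k‖ ^ 2 + Δ * (C + S - ?_ - ?_)
        exact hκ.mul_sq_sub_one_le hα (x k)
    _ = (1 - κ * Δ) * lyapunov α c a Δ N x k + Δ * (C + κ) := by
        rw [lyapunov]
        ring

theorem ofReal_lyapunov (ha : 0 ≤ a) (hac : a ≤ c) (hΔ : 0 ≤ Δ) (x : ℤ → E) (k : ℤ) :
    ENNReal.ofReal (lyapunov α c a Δ N x k) = ENNReal.ofReal (‖x k‖ ^ 2)
      + ENNReal.ofReal (Δ * delaySum c a N (fun j => ‖x j‖ ^ α) k) :=
  ENNReal.ofReal_add (sq_nonneg _) <| mul_nonneg hΔ <|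
    delaySum_nonneg ha hac (fun _ => Real.rpow_nonneg (norm_nonneg _) _) _

theorem IsDecayRate.ofReal_add_ofReal_delaySum_succ_le (hκ : IsDecayRate τ a b c κ) (hα : 2 ≤ α)
    (hN : N ≠ 0) (hΔN : Δ * N = τ) (hΔ : 0 ≤ Δ) (hΔ' : Δ ≤ 1) {p C : ℝ} {k : ℤ} (hp0 : 0 ≤ p)
    (hp : p ≤ ‖x k‖ ^ 2 + Δ * (C - b * ‖x k‖ ^ α + a * ‖x (k - N)‖ ^ α)) :
    ENNReal.ofReal p + ENNReal.ofReal (Δ * delaySum c a N (fun j => ‖x j‖ ^ α) (k + 1))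
      ≤ ENNReal.ofReal (1 - κ * Δ) * ENNReal.ofReal (lyapunov α c a Δ N x k)
        + ENNReal.ofReal (Δ * (C + κ)) := by
  have hdelay := mul_nonneg hΔ <| delaySum_nonneg (N := N) (v := fun j => ‖x j‖ ^ α) hκ.nonneg
    hκ.lt.le (fun _ => Real.rpow_nonneg (norm_nonneg _) _) (k + 1)
  rw [← ENNReal.ofReal_add hp0 hdelay,
    ← ENNReal.ofReal_mul (sub_nonneg.2 (mul_le_one₀ hκ.le_one hΔ hΔ'))]
  exact (ENNReal.ofReal_le_ofReal (hκ.add_delaySum_succ_le hα hN hΔN hΔ hp)).trans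
    ENNReal.ofReal_add_le

end Lyapunov

section Scheme

theorem exists_mem_Icc_mul_of_mem_Icc {h : ℝ} {n k : ℕ} (hnk : n < k) {t : ℝ}
    (ht : t ∈ Set.Icc (n * h) (k * h)) :
    ∃ j, n ≤ j ∧ j < k ∧ t ∈ Set.Icc (j * h) ((j + 1) * h) := by
  induction k, hnk using Nat.le_induction with
  | base => exact ⟨n, le_rfl, n.lt_succ_self, by simpa using ht⟩
  | succ k hnk ih =>
    rcases le_total t (k * h) with htk | htk
    · obtain ⟨j, hnj, hjk, hj⟩ := ih ⟨ht.1, htk⟩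
      exact ⟨j, hnj, hjk.trans k.lt_succ_self, hj⟩
    · exact ⟨k, (Nat.le_succ n).trans hnk, k.lt_succ_self, htk, by simpa using ht.2⟩

theorem stepSize_mul (τ : ℝ) (N : ℕ+) : stepSize τ N * (N : ℕ) = τ :=
  div_mul_cancel₀ _ (Nat.cast_ne_zero.2 N.ne_zero)

variable {d m : ℕ}
  {f : EuclideanSpace ℝ (Fin d) → EuclideanSpace ℝ (Fin d) → EuclideanSpace ℝ (Fin d)}
  {g : EuclideanSpace ℝ (Fin d) → EuclideanSpace ℝ (Fin d) → Matrix (Fin d) (Fin m) ℝ}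
  {Φ : Set.Ici (1 : ℝ) → ℝ≥0} {ν τ : ℝ} (hτ : 0 < τ) (N : ℕ+)
  {ξ : C(Set.Icc (-τ) 0, EuclideanSpace ℝ (Fin d))} (w : ℝ≥0 → EuclideanSpace ℝ (Fin m)) {r : ℝ}

theorem norm_initPath_le (hξ : ‖ξ‖ ≤ r) (t : ℝ) : ‖initPath hτ ξ t‖ ≤ r :=
  (ξ.norm_coe_le_norm _).trans hξ

theorem norm_truncEM_le_of_nonpos (hξ : ‖ξ‖ ≤ r) {k : ℤ} (hk : k ≤ 0) :
    ‖truncEM f g Φ ν hτ N ξ w k‖ ≤ r := by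
  rw [truncEM_of_nonpos f g Φ ν hτ N ξ w hk]
  exact (norm_truncMap_le _ _ _).trans (norm_initPath_le hτ hξ _)

theorem norm_interpEM_le_of_nonpos (hξ : ‖ξ‖ ≤ r) {t : ℝ} (ht : t ≤ 0) :
    ‖interpEM f g Φ ν hτ N ξ w t‖ ≤ r := by
  rw [interpEM, if_pos ht]
  exact (norm_truncMap_le _ _ _).trans (norm_initPath_le hτ hξ _)

theorem norm_interpEM_le_of_mem_Icc {j : ℕ} {t : ℝ}
    (ht : t ∈ Set.Icc ((j : ℝ) * stepSize τ N) (((j : ℝ) + 1) * stepSize τ N))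
    (hj : ‖truncEM f g Φ ν hτ N ξ w j‖ ≤ r) (hj' : ‖truncEM f g Φ ν hτ N ξ w (j + 1)‖ ≤ r) :
    ‖interpEM f g Φ ν hτ N ξ w t‖ ≤ r := by
  have hΔ := stepSize_pos hτ N
  rw [interpEM_of_mem_Icc f g Φ ν hτ N ξ w ht, ← mem_closedBall_zero_iff]
  refine convex_closedBall _ _ (mem_closedBall_zero_iff.2 hj) (mem_closedBall_zero_iff.2 hj')
    (div_nonneg (sub_nonneg.2 ht.2) hΔ.le) (div_nonneg (sub_nonneg.2 ht.1) hΔ.le) ?_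
  field_simp
  ring

theorem norm_temsp_le (k : ℕ) (hξ : ‖ξ‖ ≤ r)
    (hu : ∀ j ∈ Set.Icc (k - (N : ℕ)) k, ‖truncEM f g Φ ν hτ N ξ w j‖ ≤ r) :
    ‖temsp f g Φ ν hτ N ξ w k‖ ≤ r := by
  refine (ContinuousMap.norm_le _ ((norm_nonneg _).trans hξ)).2 fun ⟨θ, hθ⟩ => ?_
  change ‖interpEM f g Φ ν hτ N ξ w ((k : ℝ) * stepSize τ N + θ)‖ ≤ r
  set t := (k : ℝ) * stepSize τ N + θ with ht_def
  rcases le_or_gt t 0 with ht0 | ht0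
  · exact norm_interpEM_le_of_nonpos hτ N w hξ ht0
  have hk : k ≠ 0 := by
    rintro rfl
    simp only [Nat.cast_zero, zero_mul, zero_add] at ht_def
    exact ht0.not_ge (ht_def.trans_le hθ.2)
  have htle : t ≤ k * stepSize τ N := add_le_of_nonpos_right hθ.2
  have hlet : ((k - (N : ℕ) : ℕ) : ℝ) * stepSize τ N ≤ t := by
    rcases le_total (N : ℕ) k with hNk | hNk
    · rw [Nat.cast_sub hNk, sub_mul, mul_comm (((N : ℕ) : ℝ)), stepSize_mul, ht_def]
      linarith [hθ.1]
    · simpa [Nat.sub_eq_zero_of_le hNk] using ht0.le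
  obtain ⟨j, hj, hjk, htj⟩ := exists_mem_Icc_mul_of_mem_Icc
    (Nat.sub_lt (Nat.pos_of_ne_zero hk) N.pos) ⟨hlet, htle⟩
  exact norm_interpEM_le_of_mem_Icc hτ N w htj (hu j ⟨hj, hjk.le⟩)
    (by exact_mod_cast hu (j + 1) ⟨hj.trans j.le_succ, hjk⟩)

end Scheme

section MomentBounds

variable {d m : ℕ}
  {f : EuclideanSpace ℝ (Fin d) → EuclideanSpace ℝ (Fin d) → EuclideanSpace ℝ (Fin d)}
  {g : EuclideanSpace ℝ (Fin d) → EuclideanSpace ℝ (Fin d) → Matrix (Fin d) (Fin m) ℝ}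
  {Φ : Set.Ici (1 : ℝ) → ℝ≥0} {ν τ : ℝ} {Ω : Type*} {mΩ : MeasurableSpace Ω} {P : Measure Ω}
  {W : ℝ≥0 → Ω → EuclideanSpace ℝ (Fin m)}

/-- The filtration of the grid: the events at time `k` are those determined by the first `k`
increments of `W` over the grid, so that `u(t_k)` is adapted to it. -/
noncomputable def HasIsotropicIncrements.gridFiltration (hW : HasIsotropicIncrements W P) (τ : ℝ)
    (N : ℕ+) : Filtration ℕ mΩ :=
  pastFiltration (fun (k : ℕ) ω => pathIncrement τ N (fun t => W t ω) k)
    fun k => hW.measurable_pathIncrement τ N k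

/-- The Lyapunov functional at time `k` of the truncated scheme driven by `W`, as an extended
nonnegative random variable. -/
noncomputable def schemeEnergy
    (f : EuclideanSpace ℝ (Fin d) → EuclideanSpace ℝ (Fin d) → EuclideanSpace ℝ (Fin d))
    (g : EuclideanSpace ℝ (Fin d) → EuclideanSpace ℝ (Fin d) → Matrix (Fin d) (Fin m) ℝ)
    (Φ : Set.Ici (1 : ℝ) → ℝ≥0) (ν : ℝ) (hτ : 0 < τ) (N : ℕ+)
    (ξ : C(Set.Icc (-τ) 0, EuclideanSpace ℝ (Fin d))) (W : ℝ≥0 → Ω → EuclideanSpace ℝ (Fin m))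
    (α c a : ℝ) (k : ℕ) (ω : Ω) : ℝ≥0∞ :=
  ENNReal.ofReal (lyapunov α c a (stepSize τ N) N (truncEM f g Φ ν hτ N ξ fun t => W t ω) k)

theorem exists_lt_schemeEnergy_of_lt_norm_temsp (hτ : 0 < τ) (N : ℕ+) {α c a r : ℝ} (ha : 0 ≤ a)
    (hac : a ≤ c) {ξ : C(Set.Icc (-τ) 0, EuclideanSpace ℝ (Fin d))} (hξ : ‖ξ‖ ≤ r) {k : ℕ} {ω : Ω}
    (hω : r < ‖temsp f g Φ ν hτ N ξ (fun t => W t ω) k‖) :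
    ∃ j ≤ (N : ℕ),
      ENNReal.ofReal (r ^ 2) < schemeEnergy f g Φ ν hτ N ξ W α c a (k - (N : ℕ) + j) ω := by
  by_contra! hle
  have hr : 0 ≤ r := (norm_nonneg ξ).trans hξ
  refine hω.not_ge (norm_temsp_le hτ N _ k hξ fun j hj => ?_)
  have hj' := hle (j - (k - (N : ℕ))) (by have := hj.2; omega)
  rw [Nat.add_sub_cancel' hj.1] at hj'
  exact le_of_sq_le_sq ((sq_le_lyapunov ha hac (stepSize_pos hτ N).le j).trans
    ((ENNReal.ofReal_le_ofReal_iff (sq_nonneg r)).1 hj')) hr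

namespace HasIsotropicIncrements

section Measurability

variable (hW : HasIsotropicIncrements W P) (hf : Measurable (Function.uncurry f))
  (hg : ∀ i j, Measurable fun p : EuclideanSpace ℝ (Fin d) × EuclideanSpace ℝ (Fin d) =>
    g p.1 p.2 i j)
  (hτ : 0 < τ) (N : ℕ+) (ξ : C(Set.Icc (-τ) 0, EuclideanSpace ℝ (Fin d)))

include hW hf hg

theorem measurable_truncEM {k : ℕ} {j : ℤ} (hj : j ≤ k) :
    Measurable[hW.gridFiltration τ N k] fun ω => truncEM f g Φ ν hτ N ξ (fun t => W t ω) j := by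
  induction k generalizing j with
  | zero =>
    simp only [truncEM_of_nonpos f g Φ ν hτ N ξ _ (Int.natCast_zero ▸ hj)]
    exact measurable_const
  | succ k ih =>
    have hpast : ∀ {j : ℤ}, j ≤ k → Measurable[hW.gridFiltration τ N (k + 1)]
        fun ω => truncEM f g Φ ν hτ N ξ (fun t => W t ω) j := fun hj =>
      (ih hj).mono ((hW.gridFiltration τ N).mono k.le_succ) le_rfl
    rcases (show j ≤ k ∨ j = (k : ℤ) + 1 by omega) with hjk | rfl
    · exact hpast hjk
    have hpair := (hpast le_rfl).prodMk (hpast (j := k - (N : ℕ)) (by omega))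
    have hnoise := measurable_pastFiltration_succ
      (fun k : ℕ => hW.measurable_pathIncrement τ N k) k
    simp only [truncEM_succ f g Φ ν hτ N ξ _ (Int.natCast_nonneg k)]
    exact (continuous_truncMap f g Φ ν _).measurable.comp
      (((hpast le_rfl).add ((hf.comp hpair).const_smul (stepSize τ N))).add
        (measurable_toEuclideanLin_apply (fun i j => (hg i j).comp hpair) hnoise))

theorem measurable_schemeEnergy (α c a : ℝ) (k : ℕ) :
    Measurable[hW.gridFiltration τ N k] (schemeEnergy f g Φ ν hτ N ξ W α c a k) :=
  (measurable_lyapunov fun _ hj => hW.measurable_truncEM hf hg hτ N ξ hj).ennreal_ofReal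

theorem setLIntegral_norm_sq_truncEM_succ_le [IsProbabilityMeasure P] {α C b a : ℝ}
    (hstep : StepDissipative f g α C b a (stepSize τ N) (truncRadius f g Φ ν (stepSize τ N)))
    (k : ℕ) {A : Set Ω} (hA : MeasurableSet[hW.gridFiltration τ N k] A) :
    ∫⁻ ω in A, ENNReal.ofReal (‖truncEM f g Φ ν hτ N ξ (fun t => W t ω) (k + 1)‖ ^ 2) ∂P
      ≤ ∫⁻ ω in A, ENNReal.ofReal (‖truncEM f g Φ ν hτ N ξ (fun t => W t ω) k‖ ^ 2
        + stepSize τ N * (C - b * ‖truncEM f g Φ ν hτ N ξ (fun t => W t ω) k‖ ^ α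
          + a * ‖truncEM f g Φ ν hτ N ξ (fun t => W t ω) (k - (N : ℕ))‖ ^ α)) ∂P := by
  set u : ℤ → Ω → EuclideanSpace ℝ (Fin d) := fun j ω =>
    truncEM f g Φ ν hτ N ξ (fun t => W t ω) j
  set Z : Ω → EuclideanSpace ℝ (Fin m) := fun ω => pathIncrement τ N (fun t => W t ω) k
  have hu : Measurable[hW.gridFiltration τ N k] (u k) :=
    hW.measurable_truncEM hf hg hτ N ξ le_rfl
  have hpair : Measurable[hW.gridFiltration τ N k] fun ω => (u k ω, u (k - (N : ℕ)) ω) :=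
    hu.prodMk (hW.measurable_truncEM hf hg hτ N ξ (by omega))
  calc ∫⁻ ω in A, ENNReal.ofReal (‖u (k + 1) ω‖ ^ 2) ∂P
      ≤ ∫⁻ ω in A, ENNReal.ofReal (‖u k ω + stepSize τ N • f (u k ω) (u (k - (N : ℕ)) ω)
          + Matrix.toEuclideanLin (g (u k ω) (u (k - (N : ℕ)) ω)) (Z ω)‖ ^ 2) ∂P := by
        gcongr with ω
        exact (congrArg norm (truncEM_succ f g Φ ν hτ N ξ _ (Int.natCast_nonneg k))).trans_le
          (norm_truncMap_le _ _ _)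
    _ = ∫⁻ ω in A, ENNReal.ofReal (‖u k ω + stepSize τ N • f (u k ω) (u (k - (N : ℕ)) ω)‖ ^ 2
          + stepSize τ N * ‖g (u k ω) (u (k - (N : ℕ)) ω)‖ ^ 2) ∂P :=
        setLIntegral_norm_sq_add_toEuclideanLin_of_indep ((hW.gridFiltration τ N).le k)
          (hW.measurable_pathIncrement τ N k)
          (indep_pastFiltration _ (hW.iIndepFun_pathIncrement hτ N) k)
          (hW.isotropic_pathIncrement hτ N k)
          (hu.add ((hf.comp hpair).const_smul (stepSize τ N)))
          (fun i j => (hg i j).comp hpair) hA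
    _ ≤ ∫⁻ ω in A, ENNReal.ofReal (‖u k ω‖ ^ 2 + stepSize τ N
          * (C - b * ‖u k ω‖ ^ α + a * ‖u (k - (N : ℕ)) ω‖ ^ α)) ∂P := by
        refine lintegral_mono fun ω => ENNReal.ofReal_le_ofReal ?_
        exact hstep _ _ (norm_truncMap_le_truncRadius _ _ _) (norm_truncMap_le_truncRadius _ _ _)

theorem hasGeometricDrift_schemeEnergy [IsProbabilityMeasure P] {α a b c κ C : ℝ} (hα : 2 ≤ α)
    (hκ : IsDecayRate τ a b c κ) (hΔ : stepSize τ N ≤ 1)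
    (hstep : StepDissipative f g α C b a (stepSize τ N) (truncRadius f g Φ ν (stepSize τ N))) :
    HasGeometricDrift (schemeEnergy f g Φ ν hτ N ξ W α c a) (hW.gridFiltration τ N) P
      (ENNReal.ofReal (1 - κ * stepSize τ N)) (ENNReal.ofReal (stepSize τ N * (C + κ))) := by
  intro k A hA
  have hΔ0 := (stepSize_pos hτ N).le
  set u : ℤ → Ω → EuclideanSpace ℝ (Fin d) := fun j ω =>
    truncEM f g Φ ν hτ N ξ (fun t => W t ω) j
  set p : Ω → ℝ := fun ω => ‖u k ω‖ ^ 2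
    + stepSize τ N * (C - b * ‖u k ω‖ ^ α + a * ‖u (k - (N : ℕ)) ω‖ ^ α)
  set S : Ω → ℝ := fun ω => stepSize τ N * delaySum c a N (fun j => ‖u j ω‖ ^ α) (k + 1)
  have hp0 : ∀ ω, 0 ≤ p ω := fun ω => le_trans (by positivity) (hstep (u k ω) (u (k - (N : ℕ)) ω)
    (norm_truncMap_le_truncRadius _ _ _) (norm_truncMap_le_truncRadius _ _ _))
  have hS : Measurable fun ω => ENNReal.ofReal (S ω) :=
    ((measurable_delaySum_norm_rpow fun _ hj => (hW.measurable_truncEM hf hg hτ N ξ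
      (Int.lt_add_one_iff.1 hj)).mono ((hW.gridFiltration τ N).le k) le_rfl).const_mul
        _).ennreal_ofReal
  calc ∫⁻ ω in A, schemeEnergy f g Φ ν hτ N ξ W α c a (k + 1) ω ∂P
      = ∫⁻ ω in A, ENNReal.ofReal (‖u (k + 1) ω‖ ^ 2) ∂P + ∫⁻ ω in A, ENNReal.ofReal (S ω) ∂P := by
        rw [← lintegral_add_right _ hS]
        exact lintegral_congr fun ω => ofReal_lyapunov hκ.nonneg hκ.lt.le hΔ0 (fun j => u j ω) _
    _ ≤ ∫⁻ ω in A, ENNReal.ofReal (p ω) ∂P + ∫⁻ ω in A, ENNReal.ofReal (S ω) ∂P := by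
        gcongr ?_ + _
        exact hW.setLIntegral_norm_sq_truncEM_succ_le hf hg hτ N ξ hstep k hA
    _ ≤ ∫⁻ ω in A, ENNReal.ofReal (1 - κ * stepSize τ N) * schemeEnergy f g Φ ν hτ N ξ W α c a k ω
          + ENNReal.ofReal (stepSize τ N * (C + κ)) ∂P := by
        rw [← lintegral_add_right _ hS]
        exact lintegral_mono fun ω => hκ.ofReal_add_ofReal_delaySum_succ_le (x := fun j => u j ω)
          hα N.ne_zero (stepSize_mul τ N) hΔ0 hΔ (hp0 ω) le_rfl
    _ = _ := by
        rw [lintegral_add_right _ measurable_const, lintegral_const_mul' _ _ ENNReal.ofReal_ne_top,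
          setLIntegral_const]

theorem lintegral_schemeEnergy_le [IsProbabilityMeasure P] {α a b c κ C M B : ℝ} (hα : 2 ≤ α)
    (hκ : IsDecayRate τ a b c κ) (hΔ : stepSize τ N ≤ 1)
    (hstep : StepDissipative f g α C b a (stepSize τ N) (truncRadius f g Φ ν (stepSize τ N)))
    (hM : M ^ 2 + τ * c * M ^ α ≤ B) (hB0 : 0 ≤ B) (hB : C + κ ≤ κ * B) (hξ : ‖ξ‖ ≤ M) (k : ℕ) :
    ∫⁻ ω, schemeEnergy f g Φ ν hτ N ξ W α c a k ω ∂P ≤ ENNReal.ofReal B := by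
  have hΔ0 := (stepSize_pos hτ N).le
  have hκ0 := hκ.pos.le
  have hq : 0 ≤ 1 - κ * stepSize τ N := sub_nonneg.2 (mul_le_one₀ hκ.le_one hΔ0 hΔ)
  refine (hW.hasGeometricDrift_schemeEnergy hf hg hτ N ξ hα hκ hΔ hstep).lintegral_le ?_ ?_ k
  · have hinit : ∀ ω, schemeEnergy f g Φ ν hτ N ξ W α c a 0 ω ≤ ENNReal.ofReal B := fun ω => by
      have h := lyapunov_le (N := N) (zero_le_two.trans hα) (hκ.nonneg.trans hκ.lt.le) hκ.lt.le hΔ0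
        (fun j hj => norm_truncEM_le_of_nonpos (f := f) (g := g) (Φ := Φ) (ν := ν) hτ N
          (fun t => W t ω) hξ hj)
      rw [stepSize_mul] at h
      exact ENNReal.ofReal_le_ofReal (h.trans hM)
    simpa using lintegral_mono (μ := P) hinit
  · calc ENNReal.ofReal (1 - κ * stepSize τ N) * ENNReal.ofReal B
          + ENNReal.ofReal (stepSize τ N * (C + κ))
        ≤ ENNReal.ofReal ((1 - κ * stepSize τ N) * B)
          + ENNReal.ofReal (stepSize τ N * (κ * B)) := by
          rw [ENNReal.ofReal_mul hq]
          gcongr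
      _ = ENNReal.ofReal B := by
          rw [← ENNReal.ofReal_add (by positivity) (by positivity)]
          congr 1
          ring

theorem measure_lt_norm_temsp_le [IsProbabilityMeasure P] {α a b c κ C M B r : ℝ} (hα : 2 ≤ α)
    (hκ : IsDecayRate τ a b c κ) (hΔ : stepSize τ N ≤ 1)
    (hstep : StepDissipative f g α C b a (stepSize τ N) (truncRadius f g Φ ν (stepSize τ N)))
    (hM : M ^ 2 + τ * c * M ^ α ≤ B) (hB0 : 0 ≤ B) (hB : C + κ ≤ κ * B) (hξ : ‖ξ‖ ≤ M)
    (hr : 0 < r) (hMr : M ≤ r) (k : ℕ) :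
    P {ω | r < ‖temsp f g Φ ν hτ N ξ (fun t => W t ω) k‖}
      ≤ ENNReal.ofReal ((1 + τ * κ) * B / r ^ 2) := by
  have hΔ0 := (stepSize_pos hτ N).le
  have hκ0 := hκ.pos.le
  have hr2 : ENNReal.ofReal (r ^ 2) ≠ 0 := ENNReal.ofReal_ne_zero_iff.2 (by positivity)
  rw [ENNReal.ofReal_div_of_pos (by positivity),
    ENNReal.le_div_iff_mul_le (.inl hr2) (.inl ENNReal.ofReal_ne_top), mul_comm]
  calc ENNReal.ofReal (r ^ 2) * P {ω | r < ‖temsp f g Φ ν hτ N ξ (fun t => W t ω) k‖}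
      ≤ ENNReal.ofReal (r ^ 2) * P {ω | ∃ j ≤ (N : ℕ),
          ENNReal.ofReal (r ^ 2) < schemeEnergy f g Φ ν hτ N ξ W α c a (k - (N : ℕ) + j) ω} := by
        gcongr with ω
        exact exists_lt_schemeEnergy_of_lt_norm_temsp hτ N hκ.nonneg hκ.lt.le (hξ.trans hMr)
    _ ≤ ∫⁻ ω, schemeEnergy f g Φ ν hτ N ξ W α c a (k - (N : ℕ)) ω ∂P
          + (N : ℕ) * ENNReal.ofReal (stepSize τ N * (C + κ)) :=
        (hW.hasGeometricDrift_schemeEnergy hf hg hτ N ξ hα hκ hΔ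
          hstep).mul_measure_exists_le_lt_le (hW.measurable_schemeEnergy hf hg hτ N ξ α c a)
          (ENNReal.ofReal_le_one.2 (sub_le_self _ (by positivity))) _ _ _
    _ ≤ ENNReal.ofReal B + (N : ℕ) * ENNReal.ofReal (stepSize τ N * (κ * B)) := by
        gcongr
        exact hW.lintegral_schemeEnergy_le hf hg hτ N ξ hα hκ hΔ hstep hM hB0 hB hξ _
    _ = ENNReal.ofReal ((1 + τ * κ) * B) := by
        rw [← ENNReal.ofReal_natCast, ← ENNReal.ofReal_mul (by positivity),
          ← ENNReal.ofReal_add hB0 (by positivity)]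
        congr 1
        linear_combination (κ * B) * stepSize_mul τ N

end Measurability

end HasIsotropicIncrements

end MomentBounds

theorem proposition4p1_general {d m : ℕ} {Ω : Type*} [MeasurableSpace Ω] (P : Measure Ω)
    [IsProbabilityMeasure P] (W : ℝ≥0 → Ω → EuclideanSpace ℝ (Fin m))
    (hW : HasIsotropicIncrements W P) {τ : ℝ} (hτ : 0 < τ)
    (f : EuclideanSpace ℝ (Fin d) → EuclideanSpace ℝ (Fin d) → EuclideanSpace ℝ (Fin d))
    (g : EuclideanSpace ℝ (Fin d) → EuclideanSpace ℝ (Fin d) → Matrix (Fin d) (Fin m) ℝ)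
    (α a₁ a₂ a₃ : ℝ) (hH2 : Dissipative f g α a₁ a₂ a₃) (Φ : Set.Ici (1 : ℝ) → ℝ≥0)
    (hΦ : IsGrowthControl f g Φ) (ν : ℝ) (hν : ν ∈ Set.Icc 0 (1 / 2)) (Δ₁ : ℝ) (hΔ₁ : Δ₁ ≤ 1)
    (htr : a₃ < a₂ - 6 * truncConst f g Φ ^ 2 * Δ₁ ^ (1 - 2 * ν)) (M : ℝ) (ε : ℝ) (hε : 0 < ε) :
    ∃ Λ : ℝ, M < Λ ∧
      (⨆ (N : ℕ+) (_ : stepSize τ N ≤ Δ₁) (k : ℕ)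
        (ξ : C(Set.Icc (-τ) 0, EuclideanSpace ℝ (Fin d))) (_ : ‖ξ‖ ≤ M),
          P {ω | Λ < ‖temsp f g Φ ν hτ N ξ (fun t => W t ω) k‖}) < ENNReal.ofReal ε := by
  obtain ⟨c, κ, hκ⟩ := exists_isDecayRate hτ hH2.nonneg₃ htr
  set C := a₁ + 2 * (6 * truncConst f g Φ ^ 2 * Δ₁ ^ (1 - 2 * ν))
  obtain ⟨B, hMB, hB0, hCB⟩ : ∃ B, M ^ 2 + τ * c * M ^ α ≤ B ∧ 0 ≤ B ∧ C + κ ≤ κ * B := by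
    have hmul : Tendsto (fun B => κ * B) atTop atTop := tendsto_id.const_mul_atTop hκ.pos
    exact ((eventually_ge_atTop _).and ((eventually_ge_atTop 0).and
      (hmul.eventually_ge_atTop _))).exists
  obtain ⟨Λ, hMΛ, hΛ, hsmall⟩ : ∃ Λ, M < Λ ∧ 0 < Λ ∧ (1 + τ * κ) * B / Λ ^ 2 < ε := by
    have hlim : Tendsto (fun Λ : ℝ => (1 + τ * κ) * B / Λ ^ 2) atTop (nhds 0) :=
      tendsto_const_nhds.div_atTop (tendsto_pow_atTop two_ne_zero)
    exact ((eventually_gt_atTop M).and ((eventually_gt_atTop 0).and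
      (hlim.eventually_lt_const hε))).exists
  refine ⟨Λ, hMΛ, lt_of_le_of_lt ?_ ((ENNReal.ofReal_lt_ofReal_iff hε).2 hsmall)⟩
  refine iSup₂_le fun N hN => iSup_le fun k => iSup₂_le fun ξ hξ => ?_
  exact hW.measure_lt_norm_temsp_le hΦ.continuous_drift.measurable
    (fun i j => (hΦ.continuous_diffusion_apply i j).measurable) hτ N ξ hH2.two_le hκ
    (hN.trans hΔ₁) (hH2.stepDissipative hΦ hν (stepSize_pos hτ N) hN hΔ₁) hMB hB0 hCB hξ hΛ
    hMΛ.le k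

theorem proposition4p1 {d m : ℕ}
    {Ω : Type*} [MeasurableSpace Ω] (P : Measure Ω) [IsProbabilityMeasure P]
    (W : ℝ≥0 → Ω → EuclideanSpace ℝ (Fin m)) (hW : IsBrownianMotion W P)
    {τ : ℝ} (hτ : 0 < τ)
    (f : EuclideanSpace ℝ (Fin d) → EuclideanSpace ℝ (Fin d) → EuclideanSpace ℝ (Fin d))
    (g : EuclideanSpace ℝ (Fin d) → EuclideanSpace ℝ (Fin d) → Matrix (Fin d) (Fin m) ℝ)
    (hH1 : LocallyLipschitzCoeff f g)
    (α a₁ a₂ a₃ : ℝ) (hH2 : Dissipative f g α a₁ a₂ a₃)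
    (Φ : Set.Ici (1 : ℝ) → ℝ≥0) (hΦ : IsGrowthControl f g Φ)
    (ν : ℝ) (hν : ν ∈ Set.Ioc (0 : ℝ) (1 / 3))
    (Δ₁ : ℝ) (hΔ₁ : Δ₁ ∈ Set.Ioo (0 : ℝ) 1)
    (htr : a₃ < a₂ - 6 * truncConst f g Φ ^ 2 * Δ₁ ^ (1 - 2 * ν)) :
    ∀ M : ℝ, 0 < M → ∀ ε : ℝ, 0 < ε → ∃ Λ : ℝ, M < Λ ∧
      (⨆ (N : ℕ+) (_ : stepSize τ N ≤ Δ₁) (k : ℕ)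
        (ξ : C(Set.Icc (-τ) 0, EuclideanSpace ℝ (Fin d))) (_ : ‖ξ‖ ≤ M),
          P {ω | Λ < ‖temsp f g Φ ν hτ N ξ (fun t => W t ω) k‖}) < ENNReal.ofReal ε := by
  intro M _ ε hε
  exact proposition4p1_general P W hW.hasIsotropicIncrements hτ f g α a₁ a₂ a₃ hH2 Φ hΦ ν
    ⟨hν.1.le, hν.2.trans (by norm_num)⟩ Δ₁ hΔ₁.2.le htr M ε hε
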